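/- **Theorem 2.2.** Let $1<\gamma,\beta\le 2$, $0\le\mu\le1$, and let $\lambda,\xi_0,\xi_1$ be constants (real or complex). For $\alpha>0$ let $$I^{\alpha}g(t)=\frac1{\Gamma(\alpha)}\int_0^t (t-\tau)^{\alpha-1}g(\tau)\,d\tau ,\qquad I^0g=g,$$ and let $$D_t^{(\gamma,\beta)\mu}u=I^{\mu(2-\gamma)}\frac{d^2}{dt^2}I^{(1-\mu)(2-\beta)}u,\qquad E_{a,b}(z)=\sum_{k=0}^\infty\frac{z^k}{\Gamma(ak+b)},\qquad \delta=\beta+\mu(\gamma-\beta).$$ Let $f\in C^1(0,\infty)$ be integrable on $(0,1)$. Consider the problem $$D_t^{(\gamma,\beta)\mu}u(t)+\lambda u(t)=f(t)\quad(t>0),\qquad \lim_{t\to0+}I^{(1-\mu)(2-\beta)}u(t)=\xi_0,\qquad \lim_{t\to0+}\frac{d}{dt}I^{(1-\mu)(2-\beta)}u(t)=\xi_1 .$$ A solution is a function $u$, continuous on $(0,\infty)$ and integrable on $(0,T)$ for every $T>0$, such that $v=I^{(1-\mu)(2-\beta)}u$ is $C^2$ on $(0,\infty)$ with $v''$ integrable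 on $(0,T)$ for every $T>0$, and such that the equation holds for every $t>0$ and both initial conditions hold. Put $$u_*(t)=\xi_0t^{(\beta-2)(1-\mu)}E_{\delta,\delta+\mu(2-\gamma)-1}(-\lambda t^\delta)+\xi_1t^{\mu+(\beta-1)(1-\mu)}E_{\delta,\delta+\mu(2-\gamma)}(-\lambda t^\delta)+\int_0^t(t-\tau)^{\delta-1}E_{\delta,\delta}\big(-\lambda(t-\tau)^\delta\big)f(\tau)\,d\tau .$$ 1. Every solution equals $u_*$ on $(0,\infty)$; in particular there is at most one solution. 2. If $\mu(2-\gamma)=0$, or if $\int_0^1t^{1-\mu(2-\gamma)}|f'(t)|\,dt<\infty$ (which holds for every $f\in C^1[0,\infty)$), then $u_*$ is a solution. So for such $f$, in particular for every $f\in C^1[0,\infty)$, the problem has exactly one solution, and it is $u_*$. -/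

import Mathlib

open Set Filter Topology MeasureTheory

noncomputable section

/-- Two-parameter Mittag-Leffler function `E_{α,β}(z) = ∑ z^k / Γ(α k + β)`
(at a pole of `Γ` the convention `1 / 0 = 0` gives the usual value `1 / Γ = 0`). -/
def mittagLeffler {𝕜 : Type*} [RCLike 𝕜] (α β : ℝ) (z : 𝕜) : 𝕜 :=
  ∑' k : ℕ, z ^ k / ((Real.Gamma (α * k + β) : ℝ) : 𝕜)

/-- Riemann-Liouville fractional integral of order `α ≥ 0` with starting point `0`;
the integral of order `0` is the identity. -/
def rlIntegral {𝕜 : Type*} [RCLike 𝕜] (α : ℝ) (g : ℝ → 𝕜) (t : ℝ) : 𝕜 :=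
  if α = 0 then g t
  else (1 / Real.Gamma α) • ∫ τ in (0 : ℝ)..t, (t - τ) ^ (α - 1) • g τ

/-- Hilfer's bi-ordinal fractional derivative of orders `α, β ∈ (n - 1, n]` and type `μ`:
`I^{μ(n-α)} (d/dt)^n I^{(1-μ)(n-β)} g`. -/
def hilferDeriv {𝕜 : Type*} [RCLike 𝕜] (n : ℕ) (α β μ : ℝ) (g : ℝ → 𝕜) : ℝ → 𝕜 :=
  rlIntegral (μ * (n - α)) (iteratedDeriv n (rlIntegral ((1 - μ) * (n - β)) g))

/-- `u` solves, on `(0, ∞)`, the equation `D^{(γ,β)μ} u + lam u = f` with initial values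
`ξ₀, ξ₁` for `I^{(1-μ)(2-β)} u` and its derivative at `0+`. The first four fields
are the regularity under which all terms of the equation are classically defined. -/
structure IsHilferCauchySolution {𝕜 : Type*} [RCLike 𝕜] (γ β μ : ℝ) (lam ξ₀ ξ₁ : 𝕜)
    (f u : ℝ → 𝕜) : Prop where
  continuousOn : ContinuousOn u (Ioi 0)
  integrableOn : ∀ T : ℝ, 0 < T → IntegrableOn u (Ioc 0 T)
  contDiffOn : ContDiffOn ℝ 2 (rlIntegral ((1 - μ) * (2 - β)) u) (Ioi 0)
  integrableOn_deriv2 : ∀ T : ℝ, 0 < T →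
    IntegrableOn (iteratedDeriv 2 (rlIntegral ((1 - μ) * (2 - β)) u)) (Ioc 0 T)
  equation : ∀ t : ℝ, 0 < t → hilferDeriv 2 γ β μ u t + lam * u t = f t
  initial_zero :
    Tendsto (rlIntegral ((1 - μ) * (2 - β)) u) (𝓝[>] 0) (𝓝 ξ₀)
  initial_one :
    Tendsto (deriv (rlIntegral ((1 - μ) * (2 - β)) u)) (𝓝[>] 0) (𝓝 ξ₁)

/-- The explicit Mittag-Leffler formula, with `δ = β + μ (γ - β)`. -/
def hilferCauchyFormula {𝕜 : Type*} [RCLike 𝕜] (γ β μ : ℝ) (lam ξ₀ ξ₁ : 𝕜)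
    (f : ℝ → 𝕜) (t : ℝ) : 𝕜 :=
  let δ : ℝ := β + μ * (γ - β)
  ξ₀ * ((t ^ ((β - 2) * (1 - μ)) : ℝ) : 𝕜)
      * mittagLeffler δ (δ + μ * (2 - γ) - 1) (-lam * ((t ^ δ : ℝ) : 𝕜))
    + ξ₁ * ((t ^ (μ + (β - 1) * (1 - μ)) : ℝ) : 𝕜)
      * mittagLeffler δ (δ + μ * (2 - γ)) (-lam * ((t ^ δ : ℝ) : 𝕜))
    + ∫ τ in (0 : ℝ)..t, (((t - τ) ^ (δ - 1) : ℝ) : 𝕜)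
      * mittagLeffler δ δ (-lam * (((t - τ) ^ δ : ℝ) : 𝕜)) * f τ

end

noncomputable section

/-! Put a = (1-μ)(2-β) and b = μ(2-γ). Then a + b + δ = 2, and δ > 1 because δ is a convex
combination of β and γ; hence a + b < 1. The whole problem is equivalent to one Volterra equation.

If u is a solution and w = (I^a u)'', then Taylor's formula gives I^a u = ξ₀ + ξ₁ t + I^2 w, while
the equation says I^b w = f - λu. Since I^2 w = I^(a+δ) I^b w by the semigroup property, and the
powers are I^a of powers, I^a can be cancelled. This leaves u + λ I^δ u = G with G = ξ₀
t^(-a)/Γ(1-a) + ξ₁ t^(1-a)/Γ(2-a) + I^δ f (`volterra_of_equation`). The Neumann series ∑ (-λ)^k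
I^(δk) G solves this equation, uniquely, because the Gamma function in the denominators beats any
geometric growth (`ContIntegrable.volterraResolvent_add`, `eqOn_volterraResolvent`). Summed term by
term, it is the Mittag-Leffler formula (`hilferCauchyFormula_eq`).

Conversely, a solution of the Volterra equation solves the problem once f - λu = I^b w for an
admissible w. The powers and the I^δ term in u lie in the range of I^b, as b < 1 - a and b ≤ δ
(`exists_rlIntegral_eq_sub`), so only f itself must lie there. For b > 0 the weighted bound on f'
ensures this: I^(1-b) f is then the primitive of an integrable function φ, and f = I^b φ
(`ContIntegrable.exists_rlIntegral_eq`). -/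

/-- Functions on the half-line that are continuous on `(0, ∞)` and integrable near `0`. -/
structure ContIntegrable {E : Type*} [NormedAddCommGroup E] (g : ℝ → E) : Prop where
  continuousOn : ContinuousOn g (Ioi 0)
  integrableOn : ∀ T : ℝ, 0 < T → IntegrableOn g (Ioc 0 T)

/-! ### Beta integrals and power kernels. -/

theorem intervalIntegral_rpow_mul_sub_rpow {s r t : ℝ} (hs : 0 < s) (hr : 0 < r) (ht : 0 < t) :
    ∫ x in (0 : ℝ)..t, x ^ (s - 1) * (t - x) ^ (r - 1)
      = t ^ (s + r - 1) * (Real.Gamma s * Real.Gamma r / Real.Gamma (s + r)) := by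
  have h1 := Complex.betaIntegral_scaled (s : ℂ) (r : ℂ) ht
  rw [Complex.betaIntegral_eq_Gamma_mul_div _ _ (by simpa) (by simpa)] at h1
  apply Complex.ofReal_injective
  rw [← intervalIntegral.integral_ofReal]
  have h2 : ∫ x in (0 : ℝ)..t, ((x ^ (s - 1) * (t - x) ^ (r - 1) : ℝ) : ℂ)
      = ∫ x in (0 : ℝ)..t, (x : ℂ) ^ ((s : ℂ) - 1) * ((t : ℂ) - x) ^ ((r : ℂ) - 1) := by
    refine intervalIntegral.integral_congr fun x hx => ?_
    rw [uIcc_of_le ht.le] at hx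
    rw [Complex.ofReal_mul, Complex.ofReal_cpow hx.1, Complex.ofReal_cpow (by linarith [hx.2])]
    push_cast; rfl
  rw [h2, h1]
  push_cast
  rw [Complex.ofReal_cpow ht.le, Complex.Gamma_ofReal, Complex.Gamma_ofReal, ← Complex.ofReal_add,
    Complex.Gamma_ofReal]
  push_cast; rfl

theorem intervalIntegrable_sub_rpow {r : ℝ} (hr : 0 < r) (a b t : ℝ) :
    IntervalIntegrable (fun x : ℝ => (t - x) ^ (r - 1)) volume a b := by
  have := (intervalIntegral.intervalIntegrable_rpow' (a := t - a) (b := t - b)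
    (r := r - 1) (by linarith)).comp_sub_left t
  simpa using this

theorem continuousOn_sub_rpow (r t : ℝ) : ContinuousOn (fun x : ℝ => (t - x) ^ r) (Iio t) :=
  ContinuousOn.rpow_const (by fun_prop) fun x hx => Or.inl (sub_pos.2 hx).ne'

theorem continuousOn_rpow_const_Ioi (r : ℝ) : ContinuousOn (fun x : ℝ => x ^ r) (Ioi 0) :=
  continuousOn_id.rpow_const fun _ hx => Or.inl (ne_of_gt hx)

/-- Cutting at t/2 separates the singularities at 0 and t: on each half one factor is integrable and
the other continuous. -/
theorem intervalIntegrable_rpow_mul_sub_rpow {s r t : ℝ} (hs : 0 < s) (hr : 0 < r) (ht : 0 < t) :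
    IntervalIntegrable (fun x : ℝ => x ^ (s - 1) * (t - x) ^ (r - 1)) volume 0 t := by
  have h2 : t / 2 < t := by linarith
  refine IntervalIntegrable.trans (b := t / 2) ?_ ?_
  · refine (intervalIntegral.intervalIntegrable_rpow' (by linarith)).mul_continuousOn ?_
    refine (continuousOn_sub_rpow _ _).mono fun x hx => ?_
    rw [uIcc_of_le (by linarith)] at hx
    exact lt_of_le_of_lt hx.2 h2
  · refine (intervalIntegrable_sub_rpow hr _ _ _).continuousOn_mul ?_
    refine (continuousOn_rpow_const_Ioi _).mono fun x hx => ?_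
    rw [uIcc_of_le (by linarith)] at hx
    exact lt_of_lt_of_le (by linarith) hx.1

theorem intervalIntegrable_sub_rpow_mul_sub_rpow {s r τ t : ℝ} (hs : 0 < s) (hr : 0 < r)
    (h : τ < t) :
    IntervalIntegrable (fun x : ℝ => (t - x) ^ (r - 1) * (x - τ) ^ (s - 1)) volume τ t := by
  have := (intervalIntegrable_rpow_mul_sub_rpow hs hr (sub_pos.2 h)).comp_sub_right τ
  convert this using 1
  · ext x; rw [mul_comm]; congr 2; ring
  · ring
  · ring

theorem intervalIntegral_sub_rpow_mul_sub_rpow {s r τ t : ℝ} (hs : 0 < s) (hr : 0 < r)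
    (h : τ < t) :
    ∫ x in τ..t, (t - x) ^ (r - 1) * (x - τ) ^ (s - 1)
      = (t - τ) ^ (s + r - 1) * (Real.Gamma s * Real.Gamma r / Real.Gamma (s + r)) := by
  rw [← intervalIntegral_rpow_mul_sub_rpow hs hr (sub_pos.2 h)]
  have := intervalIntegral.integral_comp_sub_right (a := τ) (b := t)
    (fun x => x ^ (s - 1) * (t - τ - x) ^ (r - 1)) τ
  rw [sub_self] at this
  rw [← this]
  congr 1; ext x; rw [mul_comm]; congr 2; ring

/-! ### Stability of the function class. -/

namespace ContIntegrable

variable {E : Type*} [NormedAddCommGroup E] {g h : ℝ → E}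

theorem congr (hg : ContIntegrable g) (e : EqOn g h (Ioi 0)) : ContIntegrable h :=
  ⟨hg.continuousOn.congr fun _ hx => (e hx).symm, fun T hT =>
    (hg.integrableOn T hT).congr_fun (fun _ hx => e hx.1) measurableSet_Ioc⟩

theorem of_integrableOn_one (hg : ContinuousOn g (Ioi 0)) (h1 : IntegrableOn g (Ioc 0 1)) :
    ContIntegrable g := by
  refine ⟨hg, fun T hT => ?_⟩
  have h2 : IntegrableOn g (Icc 1 T) :=
    (hg.mono fun x hx => lt_of_lt_of_le one_pos hx.1).integrableOn_Icc
  refine (h1.union h2).mono_set fun x hx => ?_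
  rcases le_total x 1 with h | h
  · exact Or.inl ⟨hx.1, h⟩
  · exact Or.inr ⟨h, hx.2⟩

theorem add (hg : ContIntegrable g) (hh : ContIntegrable h) :
    ContIntegrable fun x => g x + h x :=
  ⟨hg.continuousOn.add hh.continuousOn, fun T hT =>
    (hg.integrableOn T hT).add (hh.integrableOn T hT)⟩

theorem sub (hg : ContIntegrable g) (hh : ContIntegrable h) :
    ContIntegrable fun x => g x - h x :=
  ⟨hg.continuousOn.sub hh.continuousOn, fun T hT =>
    (hg.integrableOn T hT).sub (hh.integrableOn T hT)⟩

theorem norm (hg : ContIntegrable g) : ContIntegrable fun x => ‖g x‖ :=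
  ⟨hg.continuousOn.norm, fun T hT => (hg.integrableOn T hT).norm⟩

theorem const_mul {𝕜 : Type*} [RCLike 𝕜] {g : ℝ → 𝕜} (hg : ContIntegrable g) (c : 𝕜) :
    ContIntegrable fun x => c * g x :=
  ⟨continuousOn_const.mul hg.continuousOn, fun T hT => (hg.integrableOn T hT).const_mul c⟩

theorem continuousOn_smul [NormedSpace ℝ E] (hg : ContIntegrable g) {k : ℝ → ℝ}
    (hk : ContinuousOn k (Ici 0)) : ContIntegrable fun x => k x • g x := by
  refine ⟨(hk.mono Ioi_subset_Ici_self).smul hg.continuousOn, fun T hT => ?_⟩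
  have h1 := hg.integrableOn T hT
  rw [← integrableOn_Icc_iff_integrableOn_Ioc] at h1 ⊢
  exact h1.continuousOn_smul (hk.mono Icc_subset_Ici_self) isCompact_Icc

theorem intervalIntegrable (hg : ContIntegrable g) {t : ℝ} (ht : 0 ≤ t) :
    IntervalIntegrable g volume 0 t := by
  rcases ht.eq_or_lt with rfl | ht
  · exact IntervalIntegrable.refl
  · exact (intervalIntegrable_iff_integrableOn_Ioc_of_le ht.le).2 (hg.integrableOn t ht)

theorem intervalIntegrable' (hg : ContIntegrable g) {s t : ℝ} (hs : 0 ≤ s) (ht : 0 ≤ t) :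
    IntervalIntegrable g volume s t :=
  (hg.intervalIntegrable hs).symm.trans (hg.intervalIntegrable ht)

/-- Near 0 only g may be singular, near t only the kernel, so a cut at t/2 suffices. -/
theorem intervalIntegrable_kernel [NormedSpace ℝ E] (hg : ContIntegrable g) {α t : ℝ}
    (hα : 0 < α) (ht : 0 < t) :
    IntervalIntegrable (fun τ => (t - τ) ^ (α - 1) • g τ) volume 0 t := by
  have h2 : t / 2 < t := by linarith
  refine IntervalIntegrable.trans (b := t / 2) ?_ ?_
  · refine (hg.intervalIntegrable (by linarith)).continuousOn_smul ?_
    refine (continuousOn_sub_rpow _ _).mono fun x hx => ?_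
    rw [uIcc_of_le (by linarith)] at hx
    exact lt_of_le_of_lt hx.2 h2
  · refine (intervalIntegrable_sub_rpow hα _ _ _).smul_continuousOn ?_
    refine hg.continuousOn.mono fun x hx => ?_
    rw [uIcc_of_le (by linarith)] at hx
    exact lt_of_lt_of_le (by linarith) hx.1

theorem kernel [NormedSpace ℝ E] (hg : ContIntegrable g) {α t : ℝ}
    (hα : 0 < α) (ht : 0 < t) :
    IntegrableOn (fun τ => (t - τ) ^ (α - 1) • g τ) (Ioo 0 t) := by
  rw [← integrableOn_Ioc_iff_integrableOn_Ioo]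
  exact (intervalIntegrable_iff_integrableOn_Ioc_of_le ht.le).1 (hg.intervalIntegrable_kernel hα ht)

end ContIntegrable

theorem contIntegrable_rpow {c : ℝ} (hc : 0 < c) : ContIntegrable fun x : ℝ => x ^ (c - 1) :=
  ⟨continuousOn_rpow_const_Ioi _, fun _ hT =>
    (intervalIntegrable_iff_integrableOn_Ioc_of_le hT.le).1
      (intervalIntegral.intervalIntegrable_rpow' (by linarith))⟩

/-! ### Elementary properties and bounds of the fractional integrals. -/

section rl

variable {𝕜 : Type*} [RCLike 𝕜]

theorem rlIntegral_zero (g : ℝ → 𝕜) : rlIntegral 0 g = g := by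
  ext t; simp [rlIntegral]

theorem rlIntegral_of_pos {α : ℝ} (hα : 0 < α) (g : ℝ → 𝕜) {t : ℝ} (ht : 0 < t) :
    rlIntegral α g t = (1 / Real.Gamma α) • ∫ τ in Ioo 0 t, (t - τ) ^ (α - 1) • g τ := by
  rw [rlIntegral, if_neg hα.ne', intervalIntegral.integral_of_le ht.le,
    integral_Ioc_eq_integral_Ioo]

theorem rlIntegral_one (g : ℝ → 𝕜) (t : ℝ) : rlIntegral 1 g t = ∫ τ in (0 : ℝ)..t, g τ := by
  simp [rlIntegral]

theorem rlIntegral_congr {α t : ℝ} (hα : 0 ≤ α) (ht : 0 < t) {g h : ℝ → 𝕜}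
    (e : EqOn g h (Ioi 0)) : rlIntegral α g t = rlIntegral α h t := by
  rcases hα.eq_or_lt with rfl | hα
  · simpa [rlIntegral_zero] using e ht
  · rw [rlIntegral_of_pos hα _ ht, rlIntegral_of_pos hα _ ht]
    congr 1
    exact setIntegral_congr_fun measurableSet_Ioo fun x hx => by rw [e hx.1]

theorem rlIntegral_const_mul (α : ℝ) (c : 𝕜) (g : ℝ → 𝕜) (t : ℝ) :
    rlIntegral α (fun x => c * g x) t = c * rlIntegral α g t := by
  unfold rlIntegral
  split_ifs
  · rfl
  · simp_rw [← mul_smul_comm]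
    rw [intervalIntegral.integral_const_mul, mul_smul_comm]

theorem rlIntegral_add {α t : ℝ} (hα : 0 ≤ α) (ht : 0 < t) {g h : ℝ → 𝕜}
    (hg : ContIntegrable g) (hh : ContIntegrable h) :
    rlIntegral α (fun x => g x + h x) t = rlIntegral α g t + rlIntegral α h t := by
  rcases hα.eq_or_lt with rfl | hα
  · simp [rlIntegral_zero]
  · simp_rw [rlIntegral_of_pos hα _ ht, smul_add]
    rw [integral_add (hg.kernel hα ht) (hh.kernel hα ht), smul_add]

theorem rlIntegral_sub {α t : ℝ} (hα : 0 ≤ α) (ht : 0 < t) {g h : ℝ → 𝕜}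
    (hg : ContIntegrable g) (hh : ContIntegrable h) :
    rlIntegral α (fun x => g x - h x) t = rlIntegral α g t - rlIntegral α h t := by
  have := rlIntegral_add hα ht hg (hh.const_mul (-1))
  rw [rlIntegral_const_mul] at this
  simpa [sub_eq_add_neg] using this

theorem rlIntegral_rpow {α c t : ℝ} (hα : 0 ≤ α) (hc : 0 < c) (ht : 0 < t) :
    rlIntegral α (fun x => ((x ^ (c - 1) / Real.Gamma c : ℝ) : 𝕜)) t
      = ((t ^ (c + α - 1) / Real.Gamma (c + α) : ℝ) : 𝕜) := by
  rcases hα.eq_or_lt with rfl | hα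
  · simp [rlIntegral_zero]
  have hΓ := (Real.Gamma_pos_of_pos hα).ne'
  have hΓc := (Real.Gamma_pos_of_pos hc).ne'
  rw [rlIntegral, if_neg hα.ne']
  have h1 : ∀ x : ℝ, (t - x) ^ (α - 1) • ((x ^ (c - 1) / Real.Gamma c : ℝ) : 𝕜)
      = ((x ^ (c - 1) * (t - x) ^ (α - 1) / Real.Gamma c : ℝ) : 𝕜) := fun x => by
    rw [RCLike.real_smul_eq_coe_mul, ← RCLike.ofReal_mul]; congr 1; ring
  simp_rw [h1]
  rw [intervalIntegral.intervalIntegral_eq_integral_uIoc, if_pos ht.le, one_smul]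
  rw [integral_ofReal, RCLike.real_smul_eq_coe_mul, ← RCLike.ofReal_mul]
  congr 1
  rw [uIoc_of_le ht.le, ← intervalIntegral.integral_of_le ht.le, intervalIntegral.integral_div,
    intervalIntegral_rpow_mul_sub_rpow hc hα ht]
  field_simp

theorem norm_rlIntegral_le {α t : ℝ} (hα : 0 ≤ α) (ht : 0 < t) (g : ℝ → 𝕜) :
    ‖rlIntegral α g t‖ ≤ rlIntegral α (fun x => ‖g x‖) t := by
  rcases hα.eq_or_lt with rfl | hα
  · simp [rlIntegral_zero]
  rw [rlIntegral_of_pos hα _ ht, rlIntegral_of_pos hα _ ht, norm_smul, Real.norm_of_nonneg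
    (by have := Real.Gamma_pos_of_pos hα; positivity), smul_eq_mul]
  have := Real.Gamma_pos_of_pos hα
  gcongr
  refine (norm_integral_le_integral_norm _).trans (le_of_eq ?_)
  refine setIntegral_congr_fun measurableSet_Ioo fun x hx => ?_
  rw [norm_smul, Real.norm_of_nonneg (Real.rpow_nonneg (by linarith [hx.2]) _), smul_eq_mul]

/-- For orders at least one the Riemann-Liouville kernel is bounded. -/
theorem norm_rlIntegral_le_of_one_le {α t T : ℝ} (hα : 1 ≤ α) (ht : 0 < t) (htT : t ≤ T)
    {g : ℝ → 𝕜} (hg : ContIntegrable g) :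
    ‖rlIntegral α g t‖ ≤ T ^ (α - 1) / Real.Gamma α * ∫ τ in Ioc 0 T, ‖g τ‖ := by
  have hα0 : 0 < α := by linarith
  have hΓ := Real.Gamma_pos_of_pos hα0
  refine (norm_rlIntegral_le hα0.le ht g).trans ?_
  rw [rlIntegral_of_pos hα0 _ ht, smul_eq_mul, div_eq_mul_one_div (T ^ _), mul_comm (T ^ (α - 1)),
    mul_assoc]
  gcongr
  rw [← integral_const_mul]
  have hT : 0 < T := ht.trans_le htT
  calc ∫ τ in Ioo 0 t, (t - τ) ^ (α - 1) • ‖g τ‖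
      ≤ ∫ τ in Ioo 0 t, T ^ (α - 1) * ‖g τ‖ := by
        refine setIntegral_mono_on (hg.norm.kernel hα0 ht)
          (((hg.integrableOn t ht).mono_set Ioo_subset_Ioc_self).norm.const_mul _)
          measurableSet_Ioo fun x hx => ?_
        rw [smul_eq_mul]
        gcongr
        · linarith [hx.2]
        · linarith [hx.1]
    _ ≤ _ := by
        refine setIntegral_mono_set ((hg.integrableOn T hT).norm.const_mul _) ?_ ?_
        · exact Eventually.of_forall fun x => by positivity
        · exact (Ioo_subset_Ioc_self.trans (Ioc_subset_Ioc_right htT)).eventuallyLE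

end rl

/-! ### Fubini on the triangle 0 < τ < s < t. -/

section Triangle

variable {E : Type*} [NormedAddCommGroup E] [NormedSpace ℝ E]

/-- Tonelli with s as the inner variable: B majorises the inner integral of the kernel, so
integrability of B‖g‖ is enough. -/
theorem integrable_triangle {k : ℝ → ℝ → ℝ} {B : ℝ → ℝ} {g : ℝ → E} {t : ℝ}
    (hk : Measurable (Function.uncurry k))
    (hg : AEStronglyMeasurable g (volume.restrict (Ioo 0 t)))
    (h1 : ∀ τ ∈ Ioo 0 t, IntegrableOn (fun s => k s τ) (Ioo τ t))
    (hB : ∀ τ ∈ Ioo 0 t, ∫ s in Ioo τ t, ‖k s τ‖ ≤ B τ)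
    (h2 : IntegrableOn (fun τ => B τ * ‖g τ‖) (Ioo 0 t)) :
    Integrable (fun p : ℝ × ℝ => if p.2 < p.1 then k p.1 p.2 • g p.2 else 0)
      ((volume.restrict (Ioo 0 t)).prod (volume.restrict (Ioo 0 t))) := by
  have hm : AEStronglyMeasurable (fun p : ℝ × ℝ => if p.2 < p.1 then k p.1 p.2 • g p.2 else 0)
      ((volume.restrict (Ioo 0 t)).prod (volume.restrict (Ioo 0 t))) := by
    have : (fun p : ℝ × ℝ => if p.2 < p.1 then k p.1 p.2 • g p.2 else 0)
        = {p : ℝ × ℝ | p.2 < p.1}.indicator fun p => k p.1 p.2 • g p.2 := by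
      ext p; simp [indicator]
    rw [this]
    refine AEStronglyMeasurable.indicator ?_ (measurableSet_lt measurable_snd measurable_fst)
    exact hk.aestronglyMeasurable.smul hg.comp_snd
  have e : ∀ τ, (fun s => if τ < s then k s τ • g τ else 0)
      = (Ioi τ).indicator fun s => k s τ • g τ := fun τ => by ext s; simp [indicator]
  have hset : ∀ τ ∈ Ioo 0 t, Ioo 0 t ∩ Ioi τ = Ioo τ t := fun τ hτ => by
    ext s; simp only [mem_inter_iff, mem_Ioo, mem_Ioi]
    exact ⟨fun h => ⟨h.2, h.1.2⟩, fun h => ⟨⟨hτ.1.trans h.1, h.2⟩, h.1⟩⟩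
  rw [integrable_prod_iff' hm]
  constructor
  · refine (ae_restrict_mem measurableSet_Ioo).mono fun τ hτ => ?_
    simp only
    rw [e, integrable_indicator_iff measurableSet_Ioi, IntegrableOn,
      Measure.restrict_restrict measurableSet_Ioi, inter_comm, hset τ hτ]
    exact (h1 τ hτ).smul_const _
  · refine Integrable.mono' h2 hm.norm.prod_swap.integral_prod_right' ?_
    refine (ae_restrict_mem measurableSet_Ioo).mono fun τ hτ => ?_
    have e2 : (fun s => ‖if τ < s then k s τ • g τ else 0‖)
        = (Ioi τ).indicator fun s => ‖k s τ‖ * ‖g τ‖ := by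
      ext s; by_cases h : τ < s <;> simp [h, norm_smul]
    simp only [e2]
    rw [setIntegral_indicator measurableSet_Ioi, hset τ hτ, integral_mul_const,
      Real.norm_of_nonneg (mul_nonneg (integral_nonneg fun _ => norm_nonneg _) (norm_nonneg _))]
    exact mul_le_mul_of_nonneg_right (hB τ hτ) (norm_nonneg _)

variable {k : ℝ → ℝ → ℝ} {g : ℝ → E} {t : ℝ}

theorem setIntegral_triangle_left {s : ℝ} (hs : s ∈ Ioo 0 t) :
    ∫ τ in Ioo 0 t, (if τ < s then k s τ • g τ else 0) = ∫ τ in Ioo 0 s, k s τ • g τ := by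
  have e : (fun τ => if τ < s then k s τ • g τ else 0)
      = (Iio s).indicator fun τ => k s τ • g τ := by ext s; simp [indicator]
  rw [e, setIntegral_indicator measurableSet_Iio]
  congr 2
  ext τ; simp only [mem_inter_iff, mem_Ioo, mem_Iio]
  exact ⟨fun h => ⟨h.1.1, h.2⟩, fun h => ⟨⟨h.1, h.2.trans hs.2⟩, h.2⟩⟩

theorem integrableOn_triangle
    (h : Integrable (fun p : ℝ × ℝ => if p.2 < p.1 then k p.1 p.2 • g p.2 else 0)
      ((volume.restrict (Ioo 0 t)).prod (volume.restrict (Ioo 0 t)))) :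
    IntegrableOn (fun s => ∫ τ in Ioo 0 s, k s τ • g τ) (Ioo 0 t) :=
  IntegrableOn.congr_fun h.integral_prod_left (fun _ hs => setIntegral_triangle_left hs)
    measurableSet_Ioo

theorem setIntegral_triangle_swap [CompleteSpace E]
    (h : Integrable (fun p : ℝ × ℝ => if p.2 < p.1 then k p.1 p.2 • g p.2 else 0)
      ((volume.restrict (Ioo 0 t)).prod (volume.restrict (Ioo 0 t)))) :
    ∫ s in Ioo 0 t, ∫ τ in Ioo 0 s, k s τ • g τ
      = ∫ τ in Ioo 0 t, (∫ s in Ioo τ t, k s τ) • g τ := by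
  have h1 : ∫ s in Ioo 0 t, ∫ τ in Ioo 0 s, k s τ • g τ
      = ∫ s in Ioo 0 t, ∫ τ in Ioo 0 t, (if τ < s then k s τ • g τ else 0) :=
    setIntegral_congr_fun measurableSet_Ioo fun s hs => (setIntegral_triangle_left hs).symm
  rw [h1, integral_integral_swap h]
  refine setIntegral_congr_fun measurableSet_Ioo fun τ hτ => ?_
  have e : (fun s => if τ < s then k s τ • g τ else 0)
      = (Ioi τ).indicator fun s => k s τ • g τ := by ext s; simp [indicator]
  simp only [e]
  rw [setIntegral_indicator measurableSet_Ioi, ← integral_smul_const]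
  congr 2
  ext s; simp only [mem_inter_iff, mem_Ioo, mem_Ioi]
  exact ⟨fun h => ⟨h.2, h.1.2⟩, fun h => ⟨⟨hτ.1.trans h.1, h.2⟩, h.1⟩⟩

end Triangle

/-! ### Regularity of fractional integrals and the semigroup law. -/

section BetaTriangle

theorem integrableOn_sub_rpow_mul_sub_rpow {α β τ t : ℝ} (hα : 0 < α) (hβ : 0 < β) (h : τ < t) :
    IntegrableOn (fun s => (t - s) ^ (α - 1) * (s - τ) ^ (β - 1)) (Ioo τ t) := by
  rw [← integrableOn_Ioc_iff_integrableOn_Ioo]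
  exact (intervalIntegrable_iff_integrableOn_Ioc_of_le h.le).1
    (intervalIntegrable_sub_rpow_mul_sub_rpow hβ hα h)

theorem setIntegral_sub_rpow_mul_sub_rpow {α β τ t : ℝ} (hα : 0 < α) (hβ : 0 < β) (h : τ < t) :
    ∫ s in Ioo τ t, (t - s) ^ (α - 1) * (s - τ) ^ (β - 1)
      = (t - τ) ^ (α + β - 1) * (Real.Gamma α * Real.Gamma β / Real.Gamma (α + β)) := by
  rw [← integral_Ioc_eq_integral_Ioo, ← intervalIntegral.integral_of_le h.le,
    intervalIntegral_sub_rpow_mul_sub_rpow hβ hα h]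
  ring_nf

variable {𝕜 : Type*} [RCLike 𝕜] {g : ℝ → 𝕜}

/-- The inner integral is a Beta integral, a multiple of (t-τ)^(α+β-1); what remains is the kernel
integral of order α+β of ‖g‖. -/
theorem ContIntegrable.integrable_triangle_rpow (hg : ContIntegrable g) {α β t : ℝ} (hα : 0 < α)
    (hβ : 0 < β) (ht : 0 < t) :
    Integrable (fun p : ℝ × ℝ => if p.2 < p.1 then
        ((t - p.1) ^ (α - 1) * (p.1 - p.2) ^ (β - 1)) • g p.2 else 0)
      ((volume.restrict (Ioo 0 t)).prod (volume.restrict (Ioo 0 t))) := by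
  refine integrable_triangle (k := fun s τ => (t - s) ^ (α - 1) * (s - τ) ^ (β - 1))
    (B := fun τ => (t - τ) ^ (α + β - 1) * (Real.Gamma α * Real.Gamma β / Real.Gamma (α + β)))
    ?_ ?_ ?_ ?_ ?_
  · unfold Function.uncurry; fun_prop
  · exact ((hg.integrableOn t ht).mono_set Ioo_subset_Ioc_self).aestronglyMeasurable
  · exact fun τ hτ => integrableOn_sub_rpow_mul_sub_rpow hα hβ hτ.2
  · intro τ hτ
    rw [← setIntegral_sub_rpow_mul_sub_rpow hα hβ hτ.2]
    refine (setIntegral_congr_fun measurableSet_Ioo fun s hs => ?_).le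
    exact Real.norm_of_nonneg (mul_nonneg (Real.rpow_nonneg (by linarith [hs.2]) _)
      (Real.rpow_nonneg (by linarith [hs.1]) _))
  · refine IntegrableOn.congr_fun ((hg.norm.kernel (α := α + β) (by linarith) ht).mul_const
      (Real.Gamma α * Real.Gamma β / Real.Gamma (α + β))) (fun τ hτ => ?_) measurableSet_Ioo
    rw [smul_eq_mul]
    ring

/-- The substitution s = t - τ fixes the singularity at s = 0 and moves t into the continuous factor
and the endpoint, so dominated convergence applies. -/
theorem continuousAt_intervalIntegral_sub_rpow_smul {c α t₀ : ℝ} (hα : 0 < α) (hc : c < t₀)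
    (hg : Continuous g) :
    ContinuousAt (fun t => ∫ τ in c..t, (t - τ) ^ (α - 1) • g τ) t₀ := by
  have e : (fun t => ∫ τ in c..t, (t - τ) ^ (α - 1) • g τ)
      = fun t => ∫ s in (0 : ℝ)..(t - c), s ^ (α - 1) • g (t - s) := by
    ext t
    have := intervalIntegral.integral_comp_sub_left (a := c) (b := t)
      (fun s => s ^ (α - 1) • g (t - s)) t
    simpa using this
  rw [e]
  -- The window (-1, M) for s contains 0 and t₀ - c in its interior; for |t - t₀| < 1 it keeps t - s
  -- in the compact interval below.
  set M := t₀ - c + 1 with hM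
  obtain ⟨C, hC⟩ := (isCompact_Icc (a := t₀ - 1 - M) (b := t₀ + 2)).exists_bound_of_continuousOn
    hg.continuousOn
  have key := intervalIntegral.continuousAt_parametric_primitive_of_dominated (μ := volume)
    (F := fun t s => s ^ (α - 1) • g (t - s)) (fun s => ‖s ^ (α - 1)‖ * C) (-1) M (a₀ := 0)
    (b₀ := t₀ - c) (x₀ := t₀) ?_ ?_ ?_ ?_ ⟨by norm_num, by linarith⟩ ⟨by linarith, by linarith⟩
    (by simp)
  · exact ContinuousAt.comp (f := fun t : ℝ => (t, t - c))
      (g := fun p : ℝ × ℝ => ∫ s in (0 : ℝ)..p.2, s ^ (α - 1) • g (p.1 - s)) key (by fun_prop)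
  · intro t
    have h1 : Measurable fun s : ℝ => s ^ (α - 1) := by fun_prop
    exact h1.aestronglyMeasurable.smul (by fun_prop : Continuous fun s => g (t - s)).aestronglyMeasurable
  · filter_upwards [Ioo_mem_nhds (show t₀ - 1 < t₀ by linarith) (show t₀ < t₀ + 1 by linarith)]
      with t ht
    refine (ae_restrict_mem measurableSet_uIoc).mono fun s hs => ?_
    rw [uIoc_of_le (by linarith)] at hs
    rw [norm_smul]
    gcongr
    exact hC _ ⟨by linarith [ht.1, hs.2], by linarith [ht.2, hs.1]⟩
  · exact ((intervalIntegral.intervalIntegrable_rpow' (by linarith)).norm).mul_const _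
  · refine Eventually.of_forall fun s => ?_
    have : Continuous fun t => s ^ (α - 1) • g (t - s) := by fun_prop
    exact this.continuousAt

/-- For τ ≤ c < t₀ the kernel stays away from its singularity, hence is bounded for t near t₀. -/
theorem continuousAt_intervalIntegral_sub_rpow_smul_fixed {c α t₀ : ℝ} (hc0 : 0 < c) (hc : c < t₀)
    (hg : IntervalIntegrable g volume 0 c) :
    ContinuousAt (fun t => ∫ τ in (0 : ℝ)..c, (t - τ) ^ (α - 1) • g τ) t₀ := by
  have hd : 0 < (t₀ - c) / 2 := by linarith
  obtain ⟨C, hC⟩ := (isCompact_Icc (a := (t₀ - c) / 2) (b := 2 * t₀)).exists_bound_of_continuousOn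
    (f := fun x : ℝ => x ^ (α - 1)) ((continuousOn_rpow_const_Ioi _).mono
      fun x hx => lt_of_lt_of_le hd hx.1)
  refine intervalIntegral.continuousAt_of_dominated_interval (bound := fun τ => C * ‖g τ‖)
    ?_ ?_ (hg.norm.const_mul _) ?_
  · refine Eventually.of_forall fun t => ?_
    have h1 : Measurable fun s : ℝ => (t - s) ^ (α - 1) := by fun_prop
    exact h1.aestronglyMeasurable.smul hg.def'.aestronglyMeasurable
  · filter_upwards [Ioo_mem_nhds (show (t₀ + c) / 2 < t₀ by linarith)
      (show t₀ < 2 * t₀ by linarith)] with t ht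
    refine Eventually.of_forall fun τ hτ => ?_
    rw [uIoc_of_le hc0.le] at hτ
    rw [norm_smul]
    gcongr
    exact hC _ ⟨by linarith [ht.1, hτ.2], by linarith [ht.2, hτ.1]⟩
  · refine Eventually.of_forall fun τ hτ => ?_
    rw [uIoc_of_le hc0.le] at hτ
    have h1 : 0 < t₀ - τ := by linarith [hτ.2]
    have : ContinuousAt (fun t : ℝ => (t - τ) ^ (α - 1)) t₀ :=
      ContinuousAt.rpow_const (by fun_prop) (Or.inl h1.ne')
    exact this.smul continuousAt_const

theorem ContIntegrable.rlIntegral (hg : ContIntegrable g) {α : ℝ} (hα : 0 ≤ α) :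
    ContIntegrable (rlIntegral α g) := by
  rcases hα.eq_or_lt with rfl | hα
  · rwa [rlIntegral_zero]
  constructor
  · intro t₀ ht₀
    refine ContinuousAt.continuousWithinAt ?_
    have ht₀ : 0 < t₀ := ht₀
    set c := t₀ / 2 with hcdef
    have hc0 : 0 < c := by linarith
    have hc : c < t₀ := by linarith
    -- Freezing g to the left of c gives a continuous function on the line that agrees with g on [c,
    -- t].
    have hG : Continuous fun x => g (max x c) := by
      refine hg.continuousOn.comp_continuous (by fun_prop) fun x => ?_
      exact lt_of_lt_of_le hc0 (le_max_right _ _)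
    have key := ((continuousAt_intervalIntegral_sub_rpow_smul_fixed (α := α) hc0 hc
      (hg.intervalIntegrable hc0.le)).add
      (continuousAt_intervalIntegral_sub_rpow_smul hα hc hG)).const_smul (1 / Real.Gamma α)
    refine key.congr ?_
    filter_upwards [Ioi_mem_nhds hc] with t ht
    have ht : c < t := ht
    have ht0 : 0 < t := by linarith
    have hint := hg.intervalIntegrable_kernel hα ht0
    rw [_root_.rlIntegral, if_neg hα.ne', ← intervalIntegral.integral_add_adjacent_intervals
      (b := c) (hint.mono_set ?_) (hint.mono_set ?_)]
    · simp only [Pi.smul_apply, Pi.add_apply]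
      congr 2
      refine intervalIntegral.integral_congr fun x hx => ?_
      rw [uIcc_of_le ht.le] at hx
      simp only [max_eq_left hx.1]
    · rw [uIcc_of_le hc0.le, uIcc_of_le ht0.le]; exact Icc_subset_Icc_right ht.le
    · rw [uIcc_of_le ht.le, uIcc_of_le ht0.le]; exact Icc_subset_Icc_left hc0.le
  · intro T hT
    rw [integrableOn_Ioc_iff_integrableOn_Ioo]
    -- The outer order 1 makes the outer factor (T-s)^0 = 1, so the triangle gives plain
    -- integrability of I^α g.
    have := (integrableOn_triangle (k := fun s τ => (T - s) ^ ((1 : ℝ) - 1) * (s - τ) ^ (α - 1))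
      (hg.integrable_triangle_rpow one_pos hα hT)).smul (1 / Real.Gamma α)
    refine IntegrableOn.congr_fun this (fun s hs => ?_) measurableSet_Ioo
    rw [rlIntegral_of_pos hα _ hs.1]
    simp

/-- The semigroup property of the Riemann-Liouville integrals. -/
theorem ContIntegrable.rlIntegral_rlIntegral (hg : ContIntegrable g) {α β t : ℝ} (hα : 0 ≤ α)
    (hβ : 0 ≤ β) (ht : 0 < t) :
    _root_.rlIntegral α (_root_.rlIntegral β g) t = _root_.rlIntegral (α + β) g t := by
  rcases hα.eq_or_lt with rfl | hα
  · simp [rlIntegral_zero]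
  rcases hβ.eq_or_lt with rfl | hβ
  · simp [rlIntegral_zero]
  rw [rlIntegral_of_pos hα _ ht, rlIntegral_of_pos (add_pos hα hβ) _ ht]
  have h1 : ∫ s in Ioo 0 t, (t - s) ^ (α - 1) • _root_.rlIntegral β g s
      = (1 / Real.Gamma β) • ∫ s in Ioo 0 t, ∫ τ in Ioo 0 s,
        ((t - s) ^ (α - 1) * (s - τ) ^ (β - 1)) • g τ := by
    rw [← integral_smul]
    refine setIntegral_congr_fun measurableSet_Ioo fun s hs => ?_
    rw [rlIntegral_of_pos hβ _ hs.1, smul_comm, ← integral_smul]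
    simp only [smul_smul]
  have h2 : ∫ τ in Ioo 0 t, (∫ s in Ioo τ t, (t - s) ^ (α - 1) * (s - τ) ^ (β - 1)) • g τ
      = (Real.Gamma α * Real.Gamma β / Real.Gamma (α + β)) •
        ∫ τ in Ioo 0 t, (t - τ) ^ (α + β - 1) • g τ := by
    rw [← integral_smul]
    refine setIntegral_congr_fun measurableSet_Ioo fun τ hτ => ?_
    rw [setIntegral_sub_rpow_mul_sub_rpow hα hβ hτ.2, mul_comm, mul_smul]
  rw [h1, setIntegral_triangle_swap (k := fun s τ => (t - s) ^ (α - 1) * (s - τ) ^ (β - 1))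
    (hg.integrable_triangle_rpow hα hβ ht), h2, smul_smul, smul_smul]
  have := (Real.Gamma_pos_of_pos hα).ne'
  have := (Real.Gamma_pos_of_pos hβ).ne'
  congr 1
  field_simp

end BetaTriangle

/-! ### Integration of order one and injectivity of I^α. -/

section Calculus

variable {𝕜 : Type*} [RCLike 𝕜] {g h : ℝ → 𝕜}

theorem ContIntegrable.hasDerivAt_rlIntegral_one (hg : ContIntegrable g) {t : ℝ} (ht : 0 < t) :
    HasDerivAt (_root_.rlIntegral 1 g) (g t) t := by
  have e : _root_.rlIntegral 1 g = fun t => ∫ τ in (0 : ℝ)..t, g τ := by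
    ext t; exact rlIntegral_one g t
  rw [e]
  exact intervalIntegral.integral_hasDerivAt_right (hg.intervalIntegrable ht.le)
    (hg.continuousOn.stronglyMeasurableAtFilter isOpen_Ioi t ht)
    (hg.continuousOn.continuousAt (Ioi_mem_nhds ht))

theorem ContIntegrable.tendsto_rlIntegral_one (hg : ContIntegrable g) :
    Tendsto (_root_.rlIntegral 1 g) (𝓝[>] 0) (𝓝 0) := by
  have h1 : ContinuousOn (fun t => ∫ τ in (0 : ℝ)..t, g τ) (uIcc 0 1) := by
    refine intervalIntegral.continuousOn_primitive_interval ?_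
    have := hg.integrableOn 1 one_pos
    rwa [uIcc_of_le zero_le_one, integrableOn_Icc_iff_integrableOn_Ioc]
  have h2 := h1 0 (by simp)
  rw [ContinuousWithinAt, intervalIntegral.integral_same] at h2
  have e : _root_.rlIntegral 1 g = fun t => ∫ τ in (0 : ℝ)..t, g τ := by
    ext t; exact rlIntegral_one g t
  rw [e]
  refine h2.mono_left ?_
  rw [uIcc_of_le zero_le_one]
  refine nhdsWithin_le_iff.2 ?_
  exact mem_of_superset (Ioc_mem_nhdsGT one_pos) Ioc_subset_Icc_self

theorem eq_add_rlIntegral_one {p : ℝ → 𝕜} {L : 𝕜} (hg : ContIntegrable g)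
    (hp : ∀ t, 0 < t → HasDerivAt p (g t) t) (hL : Tendsto p (𝓝[>] 0) (𝓝 L)) {t : ℝ}
    (ht : 0 < t) : p t = L + rlIntegral 1 g t := by
  rw [rlIntegral_one, intervalIntegral.integral_eq_sub_of_hasDerivAt_of_tendsto ht
    (fun x hx => hp x hx.1) (hg.intervalIntegrable ht.le) hL
    ((hp t ht).continuousAt.tendsto.mono_left nhdsWithin_le_nhds)]
  ring

theorem ContIntegrable.eqOn_of_rlIntegral_one_eq (hg : ContIntegrable g) (hh : ContIntegrable h)
    (e : EqOn (_root_.rlIntegral 1 g) (_root_.rlIntegral 1 h) (Ioi 0)) : EqOn g h (Ioi 0) := by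
  intro t ht
  have h1 := hg.hasDerivAt_rlIntegral_one ht
  have h2 := hh.hasDerivAt_rlIntegral_one ht
  exact h1.unique (h2.congr_of_eventuallyEq (e.eventuallyEq_of_mem (Ioi_mem_nhds ht)))

/-- Abel's inversion: applying I^(1-α) to both sides gives equal ordinary primitives, which are then
differentiated. -/
theorem ContIntegrable.eqOn_of_rlIntegral_eq (hg : ContIntegrable g) (hh : ContIntegrable h)
    {α : ℝ} (hα : 0 ≤ α) (hα1 : α ≤ 1)
    (e : EqOn (_root_.rlIntegral α g) (_root_.rlIntegral α h) (Ioi 0)) : EqOn g h (Ioi 0) := by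
  refine hg.eqOn_of_rlIntegral_one_eq hh fun t ht => ?_
  have h1 := hg.rlIntegral_rlIntegral (sub_nonneg.2 hα1) hα ht
  have h2 := hh.rlIntegral_rlIntegral (sub_nonneg.2 hα1) hα ht
  rw [sub_add_cancel] at h1 h2
  rw [← h1, ← h2]
  exact rlIntegral_congr (sub_nonneg.2 hα1) ht e

end Calculus

/-! ### Neumann series of the Volterra equation. -/

theorem summable_pow_mul_rpow_div_Gamma {r T δ c : ℝ} (hr : 0 ≤ r) (hT : 0 < T) (hδ : 1 ≤ δ)
    (hc : 0 ≤ c) :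
    Summable fun k : ℕ => r ^ k * (T ^ (c + δ * k - 1) / Real.Gamma (c + δ * k)) := by
  -- After dropping two terms the Gamma arguments are at least k + 2, where Γ is monotone and Γ(k+2)
  -- = (k+1)!, so the exponential series dominates. This also removes Γ(0) when c = 0.
  rw [← summable_nat_add_iff 2]
  set M := r * T ^ δ with hM
  have hM0 : 0 ≤ M := by positivity
  have hs := ((summable_nat_add_iff 1).2 (Real.summable_pow_div_factorial M)).mul_left
    (M * T ^ (c - 1))
  have hbig : ∀ k : ℕ, ((k : ℝ) + 2) ≤ c + δ * ((k + 2 : ℕ) : ℝ) := fun k => by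
    push_cast
    nlinarith [mul_le_mul_of_nonneg_right hδ (show (0 : ℝ) ≤ (k : ℝ) + 2 by positivity)]
  refine Summable.of_nonneg_of_le (fun k => ?_) (fun k => ?_) hs
  · have := Real.Gamma_pos_of_pos (lt_of_lt_of_le (by positivity) (hbig k))
    positivity
  · have h1 : T ^ (c + δ * ((k + 2 : ℕ) : ℝ) - 1) = T ^ (c - 1) * (T ^ δ) ^ (k + 2) := by
      rw [← Real.rpow_natCast, ← Real.rpow_mul hT.le, ← Real.rpow_add hT]; congr 1; ring
    have h2 : ((k + 1).factorial : ℝ) ≤ Real.Gamma (c + δ * ((k + 2 : ℕ) : ℝ)) := by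
      have h3 := Real.Gamma_strictMonoOn_Ici.monotoneOn (a := (k : ℝ) + 2) (by simp)
        (by simp only [mem_Ici]; linarith [hbig k, (Nat.cast_nonneg k : (0 : ℝ) ≤ k)]) (hbig k)
      refine le_trans (le_of_eq ?_) h3
      rw [← Real.Gamma_nat_eq_factorial]; push_cast; congr 1; ring
    calc r ^ (k + 2) * (T ^ (c + δ * ((k + 2 : ℕ) : ℝ) - 1) / Real.Gamma (c + δ * ((k + 2 : ℕ) : ℝ)))
        ≤ r ^ (k + 2) * (T ^ (c + δ * ((k + 2 : ℕ) : ℝ) - 1) / (k + 1).factorial) := by gcongr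
      _ = _ := by rw [h1, hM]; ring

section Resolvent

variable {𝕜 : Type*} [RCLike 𝕜] {g : ℝ → 𝕜} {δ : ℝ} {lam : 𝕜}

/-- The Neumann series `∑ (-lam)^k I^{δ k} g` of the Volterra operator `1 + lam I^δ`. -/
def volterraResolvent (δ : ℝ) (lam : 𝕜) (g : ℝ → 𝕜) (t : ℝ) : 𝕜 :=
  ∑' k : ℕ, (-lam) ^ k * rlIntegral (δ * k) g t

theorem one_le_mul_succ (hδ : 1 ≤ δ) (k : ℕ) : 1 ≤ δ * ((k + 1 : ℕ) : ℝ) := by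
  push_cast
  nlinarith [mul_le_mul_of_nonneg_right hδ (show (0 : ℝ) ≤ (k : ℝ) + 1 by positivity),
    (Nat.cast_nonneg k : (0 : ℝ) ≤ k)]

/-- The majorant of the terms of the Neumann series on `(0, T]`. -/
def neumannBound (δ : ℝ) (lam : 𝕜) (g : ℝ → 𝕜) (T : ℝ) (k : ℕ) : ℝ :=
  ‖lam‖ ^ k * (T ^ (δ * k - 1) / Real.Gamma (δ * k)) * ∫ τ in Ioc 0 T, ‖g τ‖

theorem summable_neumannBound (hδ : 1 ≤ δ) {T : ℝ} (hT : 0 < T) :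
    Summable (neumannBound δ lam g T) := by
  have := (summable_pow_mul_rpow_div_Gamma (norm_nonneg lam) hT hδ le_rfl).mul_right
    (∫ τ in Ioc 0 T, ‖g τ‖)
  simp only [zero_add] at this
  exact this

theorem ContIntegrable.norm_neumann_term_le (hg : ContIntegrable g) (hδ : 1 ≤ δ) {t T : ℝ}
    (ht : 0 < t) (htT : t ≤ T) (k : ℕ) :
    ‖(-lam) ^ (k + 1) * _root_.rlIntegral (δ * ((k + 1 : ℕ) : ℝ)) g t‖
      ≤ neumannBound δ lam g T (k + 1) := by
  rw [norm_mul, norm_pow, norm_neg, neumannBound, mul_assoc]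
  gcongr
  exact norm_rlIntegral_le_of_one_le (one_le_mul_succ hδ k) ht htT hg

theorem ContIntegrable.summable_neumann (hg : ContIntegrable g) (hδ : 1 ≤ δ) {t : ℝ}
    (ht : 0 < t) :
    Summable fun k : ℕ => (-lam) ^ k * _root_.rlIntegral (δ * k) g t := by
  rw [← summable_nat_add_iff 1]
  exact Summable.of_norm_bounded ((summable_nat_add_iff 1).2 (summable_neumannBound hδ ht))
    fun k => hg.norm_neumann_term_le hδ ht le_rfl k

/-- The term k = 0 is g, possibly unbounded at 0, and is split off. The others have order at least
one, so their series converges uniformly on (0, T] to a bounded continuous function. -/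
theorem ContIntegrable.volterraResolvent (hg : ContIntegrable g) (hδ : 1 ≤ δ) :
    ContIntegrable (volterraResolvent δ lam g) := by
  set S : ℝ → 𝕜 := fun t =>
    ∑' k : ℕ, (-lam) ^ (k + 1) * _root_.rlIntegral (δ * ((k + 1 : ℕ) : ℝ)) g t with hS
  have hcont : ∀ T, 0 < T → ContinuousOn S (Ioc 0 T) := fun T hT =>
    continuousOn_tsum (fun k => continuousOn_const.mul
      ((hg.rlIntegral (by linarith [one_le_mul_succ hδ k])).continuousOn.mono Ioc_subset_Ioi_self))
      ((summable_nat_add_iff 1).2 (summable_neumannBound (lam := lam) (g := g) hδ hT))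
      fun k t ht => hg.norm_neumann_term_le hδ ht.1 ht.2 k
  have hSreg : ContIntegrable S := by
    constructor
    · intro t ht
      have ht : 0 < t := ht
      exact ((hcont (t + 1) (by linarith)).continuousAt
        (Ioc_mem_nhds ht (by linarith))).continuousWithinAt
    · intro T hT
      refine IntegrableOn.of_bound (by simp) ((hcont T hT).aestronglyMeasurable measurableSet_Ioc)
        (∑' k, neumannBound δ lam g T (k + 1)) ?_
      refine (ae_restrict_mem measurableSet_Ioc).mono fun t ht => ?_
      exact tsum_of_norm_bounded
        ((summable_nat_add_iff 1).2 (summable_neumannBound (lam := lam) (g := g) hδ hT)).hasSum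
        fun k => hg.norm_neumann_term_le hδ ht.1 ht.2 k
  refine (hg.add hSreg).congr fun t ht => ?_
  rw [_root_.volterraResolvent, (hg.summable_neumann hδ ht).tsum_eq_zero_add]
  simp [rlIntegral_zero, hS]

/-- I^δ passes through the series because the L¹ norms are summable: up to Γ(δ) they are at most
‖λ‖^k I^δ I^(δk) ‖g‖ = ‖λ‖^k I^(δ(k+1)) ‖g‖, whose order is at least one. -/
theorem ContIntegrable.hasSum_rlIntegral_neumann (hg : ContIntegrable g) (hδ : 1 ≤ δ) {t : ℝ}
    (ht : 0 < t) :
    HasSum (fun k : ℕ => (-lam) ^ k * _root_.rlIntegral (δ * ((k + 1 : ℕ) : ℝ)) g t)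
      (_root_.rlIntegral δ (_root_.volterraResolvent δ lam g) t) := by
  have hδ0 : 0 < δ := by linarith
  have hk0 : ∀ k : ℕ, 0 ≤ δ * (k : ℝ) := fun k => by positivity
  have hΓ := Real.Gamma_pos_of_pos hδ0
  have hsum : Summable fun k : ℕ =>
      ∫ τ in Ioo 0 t, ‖(t - τ) ^ (δ - 1) • ((-lam) ^ k * _root_.rlIntegral (δ * k) g τ)‖ := by
    have hb := ((summable_pow_mul_rpow_div_Gamma (norm_nonneg lam) ht hδ hδ0.le).mul_right
      (∫ τ in Ioc 0 t, ‖g τ‖)).mul_left (Real.Gamma δ)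
    refine Summable.of_nonneg_of_le (fun k => integral_nonneg fun τ => norm_nonneg _)
      (fun k => ?_) hb
    have e : δ * ((k + 1 : ℕ) : ℝ) = δ + δ * k := by push_cast; ring
    have hr := (hg.norm.rlIntegral (hk0 k)).kernel hδ0 ht
    have h3 := norm_rlIntegral_le_of_one_le (one_le_mul_succ hδ k) ht le_rfl hg.norm
    simp only [norm_norm] at h3
    rw [e, ← hg.norm.rlIntegral_rlIntegral hδ0.le (hk0 k) ht] at h3
    have h4 := (le_abs_self _).trans h3
    rw [rlIntegral_of_pos hδ0 _ ht, smul_eq_mul] at h4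
    calc ∫ τ in Ioo 0 t, ‖(t - τ) ^ (δ - 1) • ((-lam) ^ k * _root_.rlIntegral (δ * k) g τ)‖
        ≤ ∫ τ in Ioo 0 t, ‖lam‖ ^ k *
            ((t - τ) ^ (δ - 1) • _root_.rlIntegral (δ * k) (fun x => ‖g x‖) τ) := by
          refine setIntegral_mono_on
            (((hg.rlIntegral (hk0 k)).const_mul _).kernel hδ0 ht).norm (hr.const_mul _)
            measurableSet_Ioo fun τ hτ => ?_
          have h0 : 0 ≤ t - τ := by linarith [hτ.2]
          rw [norm_smul, norm_mul, norm_pow, norm_neg,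
            Real.norm_of_nonneg (Real.rpow_nonneg h0 _), smul_eq_mul]
          have := norm_rlIntegral_le (hk0 k) hτ.1 g
          calc _ = ‖lam‖ ^ k * ((t - τ) ^ (δ - 1) * ‖_root_.rlIntegral (δ * k) g τ‖) := by ring
            _ ≤ _ := by gcongr
      _ = Real.Gamma δ * (‖lam‖ ^ k * (1 / Real.Gamma δ * ∫ τ in Ioo 0 t,
            (t - τ) ^ (δ - 1) • _root_.rlIntegral (δ * k) (fun x => ‖g x‖) τ)) := by
          rw [integral_const_mul]
          field_simp
      _ ≤ _ := by
          rw [mul_assoc (‖lam‖ ^ k)]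
          gcongr
  have key := hasSum_integral_of_summable_integral_norm (fun k : ℕ =>
    ((hg.rlIntegral (hk0 k)).const_mul ((-lam) ^ k)).kernel hδ0 ht) hsum
  have key2 := key.const_smul (1 / Real.Gamma δ)
  have e1 : (fun k : ℕ => (-lam) ^ k * _root_.rlIntegral (δ * ((k + 1 : ℕ) : ℝ)) g t)
      = fun k : ℕ => (1 / Real.Gamma δ) • ∫ τ in Ioo 0 t,
        (t - τ) ^ (δ - 1) • ((-lam) ^ k * _root_.rlIntegral (δ * k) g τ) := by
    ext k
    have e : δ * ((k + 1 : ℕ) : ℝ) = δ + δ * k := by push_cast; ring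
    rw [e, ← hg.rlIntegral_rlIntegral hδ0.le (hk0 k) ht, ← rlIntegral_const_mul,
      rlIntegral_of_pos hδ0 _ ht]
  have e2 : ∫ τ in Ioo 0 t, (t - τ) ^ (δ - 1) • _root_.volterraResolvent δ lam g τ
      = ∫ τ in Ioo 0 t, ∑' k : ℕ,
        (t - τ) ^ (δ - 1) • ((-lam) ^ k * _root_.rlIntegral (δ * k) g τ) :=
    setIntegral_congr_fun measurableSet_Ioo fun τ hτ =>
      ((hg.summable_neumann hδ hτ.1).tsum_const_smul _).symm
  rw [e1, rlIntegral_of_pos hδ0 _ ht, e2]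
  exact key2

/-- Applying λ I^δ shifts the Neumann series by one index and changes its sign; only the zeroth term
g survives. -/
theorem ContIntegrable.volterraResolvent_add (hg : ContIntegrable g) (hδ : 1 ≤ δ) {t : ℝ}
    (ht : 0 < t) :
    _root_.volterraResolvent δ lam g t
      + lam * _root_.rlIntegral δ (_root_.volterraResolvent δ lam g) t = g t := by
  have h1 := (hg.hasSum_rlIntegral_neumann (lam := lam) hδ ht).mul_left lam
  have h2 : _root_.volterraResolvent δ lam g t = g t
      + ∑' k : ℕ, (-lam) ^ (k + 1) * _root_.rlIntegral (δ * ((k + 1 : ℕ) : ℝ)) g t := by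
    rw [_root_.volterraResolvent, (hg.summable_neumann hδ ht).tsum_eq_zero_add]
    simp [rlIntegral_zero]
  have h3 : ∑' k : ℕ, (-lam) ^ (k + 1) * _root_.rlIntegral (δ * ((k + 1 : ℕ) : ℝ)) g t
      = -(lam * _root_.rlIntegral δ (_root_.volterraResolvent δ lam g) t) := by
    rw [← h1.tsum_eq, ← tsum_neg]
    congr 1; ext k; ring
  rw [h2, h3]; ring

/-- The Volterra equation `u + lam I^δ u = g` has at most one solution. -/
theorem eqOn_volterraResolvent {u : ℝ → 𝕜} (hg : ContIntegrable g) (hu : ContIntegrable u)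
    (hδ : 1 ≤ δ) (e : ∀ t, 0 < t → u t + lam * rlIntegral δ u t = g t) :
    EqOn u (volterraResolvent δ lam g) (Ioi 0) := by
  have hδ0 : 0 ≤ δ := by linarith
  have hR := hg.volterraResolvent (lam := lam) hδ
  have hd := hu.sub hR
  set d : ℝ → 𝕜 := fun x => u x - volterraResolvent δ lam g x with hdef
  have h1 : EqOn d (fun t => (-lam) * rlIntegral δ d t) (Ioi 0) := fun t ht => by
    have h2 := e t ht
    have h3 := hg.volterraResolvent_add (lam := lam) hδ ht
    simp only
    rw [hdef, rlIntegral_sub hδ0 ht hu hR]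
    linear_combination h2 - h3
  -- Iterating d = -λ I^δ d makes the constant d(t) equal to every term of a convergent Neumann
  -- series, hence zero.
  have h2 : ∀ n : ℕ, ∀ t, 0 < t → d t = (-lam) ^ n * rlIntegral (δ * n) d t := by
    intro n
    induction n with
    | zero => intro t _; simp [rlIntegral_zero]
    | succ n ih =>
      intro t ht
      have h0 : 0 ≤ δ * (n : ℝ) := by positivity
      rw [ih t ht, rlIntegral_congr h0 ht h1, rlIntegral_const_mul,
        hd.rlIntegral_rlIntegral h0 hδ0 ht, pow_succ, mul_assoc]
      push_cast
      rw [mul_add, mul_one]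
  intro t ht
  have h3 := (hd.summable_neumann (lam := lam) hδ ht).tendsto_atTop_zero
  have h4 : Tendsto (fun _ : ℕ => d t) atTop (𝓝 0) := h3.congr fun n => (h2 n t ht).symm
  exact sub_eq_zero.1 (tendsto_nhds_unique tendsto_const_nhds h4)

end Resolvent

/-! ### Mittag-Leffler functions as sums of fractional integrals. -/

section MittagLeffler

variable {𝕜 : Type*} [RCLike 𝕜] {f : ℝ → 𝕜} {δ : ℝ} {lam : 𝕜}

theorem hasSum_mittagLeffler (lam : 𝕜) {c t : ℝ} (hδ : 1 ≤ δ) (hc : 0 < c) (ht : 0 < t) :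
    HasSum (fun k : ℕ => (-lam) ^ k *
        ((t ^ (c + δ * k - 1) / Real.Gamma (c + δ * k) : ℝ) : 𝕜))
      (((t ^ (c - 1) : ℝ) : 𝕜) * mittagLeffler δ c (-lam * ((t ^ δ : ℝ) : 𝕜))) := by
  have hsum : Summable fun k : ℕ => (-lam) ^ k *
      ((t ^ (c + δ * k - 1) / Real.Gamma (c + δ * k) : ℝ) : 𝕜) := by
    refine Summable.of_norm_bounded
      (summable_pow_mul_rpow_div_Gamma (norm_nonneg lam) ht hδ hc.le) fun k => ?_
    have : 0 < Real.Gamma (c + δ * k) := Real.Gamma_pos_of_pos (by positivity)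
    rw [norm_mul, norm_pow, norm_neg, RCLike.norm_ofReal, abs_of_nonneg (by positivity)]
  have e : ((t ^ (c - 1) : ℝ) : 𝕜) * mittagLeffler δ c (-lam * ((t ^ δ : ℝ) : 𝕜))
      = ∑' k : ℕ, (-lam) ^ k *
        ((t ^ (c + δ * k - 1) / Real.Gamma (c + δ * k) : ℝ) : 𝕜) := by
    rw [mittagLeffler, ← tsum_mul_left]
    congr 1; ext k
    have h1 : t ^ (c + δ * k - 1) = t ^ (c - 1) * (t ^ δ) ^ k := by
      rw [← Real.rpow_natCast, ← Real.rpow_mul ht.le, ← Real.rpow_add ht]; congr 1; ring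
    rw [h1, mul_pow, add_comm c]
    push_cast
    ring
  rw [e]
  exact hsum.hasSum

/-- Expanding the Mittag-Leffler kernel turns the convolution into a series of I^(δ(k+1)) f. The L¹
norms of the terms are ‖λ‖^k I^(δ(k+1)) ‖f‖, which are summable. -/
theorem ContIntegrable.hasSum_rlIntegral_add (hf : ContIntegrable f) (hδ : 1 ≤ δ) {t : ℝ}
    (ht : 0 < t) :
    HasSum (fun k : ℕ => (-lam) ^ k * _root_.rlIntegral (δ * k + δ) f t)
      (∫ τ in (0 : ℝ)..t, (((t - τ) ^ (δ - 1) : ℝ) : 𝕜)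
        * mittagLeffler δ δ (-lam * (((t - τ) ^ δ : ℝ) : 𝕜)) * f τ) := by
  have hδ0 : 0 < δ := by linarith
  have hc0 : ∀ k : ℕ, 0 < δ * (k : ℝ) + δ := fun k => by positivity
  set F : ℕ → ℝ → 𝕜 := fun k τ => ((-lam) ^ k *
    (((t - τ) ^ (δ + δ * k - 1) / Real.Gamma (δ + δ * k) : ℝ) : 𝕜)) * f τ with hF
  have hFeq : ∀ k τ, F k τ = ((-lam) ^ k * ((1 / Real.Gamma (δ * k + δ) : ℝ) : 𝕜)) *
      ((t - τ) ^ (δ * k + δ - 1) • f τ) := fun k τ => by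
    simp only [hF]
    rw [RCLike.real_smul_eq_coe_mul, add_comm δ]
    push_cast
    ring
  have hInt : ∀ k, IntegrableOn (F k) (Ioo 0 t) := fun k =>
    ((hf.kernel (hc0 k) ht).const_mul
      ((-lam) ^ k * ((1 / Real.Gamma (δ * k + δ) : ℝ) : 𝕜))).congr
      (Eventually.of_forall fun τ => (hFeq k τ).symm)
  have hnorm : ∀ k, ∫ τ in Ioo 0 t, ‖F k τ‖
      = ‖lam‖ ^ k * _root_.rlIntegral (δ * k + δ) (fun x => ‖f x‖) t := fun k => by
    have hΓ := Real.Gamma_pos_of_pos (hc0 k)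
    rw [rlIntegral_of_pos (hc0 k) _ ht, smul_eq_mul, ← mul_assoc, ← integral_const_mul]
    refine setIntegral_congr_fun measurableSet_Ioo fun τ hτ => ?_
    have h0 : 0 ≤ t - τ := by linarith [hτ.2]
    rw [hFeq, norm_mul, norm_mul, norm_pow, norm_neg, RCLike.norm_ofReal,
      abs_of_nonneg (by positivity), norm_smul, Real.norm_of_nonneg (Real.rpow_nonneg h0 _),
      smul_eq_mul]
  have hsum : Summable fun k => ∫ τ in Ioo 0 t, ‖F k τ‖ := by
    refine Summable.of_nonneg_of_le (fun k => integral_nonneg fun τ => norm_nonneg _)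
      (fun k => ?_) ((summable_pow_mul_rpow_div_Gamma (norm_nonneg lam) ht hδ hδ0.le).mul_right
        (∫ τ in Ioc 0 t, ‖f τ‖))
    rw [hnorm, mul_assoc]
    gcongr
    have h3 := norm_rlIntegral_le_of_one_le (one_le_mul_succ hδ k) ht le_rfl hf.norm
    simp only [norm_norm] at h3
    have e : δ * ((k + 1 : ℕ) : ℝ) = δ * k + δ := by push_cast; ring
    rw [e] at h3
    rw [add_comm δ]
    exact (le_abs_self _).trans h3
  have key := hasSum_integral_of_summable_integral_norm hInt hsum
  have e1 : (fun k : ℕ => (-lam) ^ k * _root_.rlIntegral (δ * k + δ) f t)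
      = fun k => ∫ τ in Ioo 0 t, F k τ := by
    ext k
    rw [rlIntegral_of_pos (hc0 k) _ ht, RCLike.real_smul_eq_coe_mul, ← mul_assoc,
      ← integral_const_mul]
    exact setIntegral_congr_fun measurableSet_Ioo fun τ _ => (hFeq k τ).symm
  have e2 : ∫ τ in (0 : ℝ)..t, (((t - τ) ^ (δ - 1) : ℝ) : 𝕜)
        * mittagLeffler δ δ (-lam * (((t - τ) ^ δ : ℝ) : 𝕜)) * f τ
      = ∫ τ in Ioo 0 t, ∑' k, F k τ := by
    rw [intervalIntegral.integral_of_le ht.le, integral_Ioc_eq_integral_Ioo]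
    refine setIntegral_congr_fun measurableSet_Ioo fun τ hτ => ?_
    exact (((hasSum_mittagLeffler lam hδ hδ0 (sub_pos.2 hτ.2)).mul_right (f τ)).tsum_eq).symm
  rw [e1, e2]
  exact key

end MittagLeffler

/-! ### Integrability and limits at the origin. -/

section Tail

/-- Tonelli trades the tail integral of h for the primitive of w. -/
theorem integrableOn_mul_integral_tail {w h : ℝ → ℝ} {T : ℝ} (hw : Measurable w)
    (hw0 : ∀ τ ∈ Ioo 0 T, 0 ≤ w τ) (hh0 : ∀ s ∈ Ioo 0 T, 0 ≤ h s)
    (hh : AEStronglyMeasurable h (volume.restrict (Ioo 0 T)))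
    (h1 : ∀ s ∈ Ioo 0 T, IntegrableOn w (Ioo 0 s))
    (h2 : IntegrableOn (fun s => (∫ τ in Ioo 0 s, w τ) * h s) (Ioo 0 T)) :
    IntegrableOn (fun τ => w τ * ∫ s in Ioo τ T, h s) (Ioo 0 T) := by
  set F : ℝ × ℝ → ℝ := {p : ℝ × ℝ | p.2 < p.1}.indicator fun p => w p.2 * h p.1 with hF
  have hm : AEStronglyMeasurable F
      ((volume.restrict (Ioo 0 T)).prod (volume.restrict (Ioo 0 T))) :=
    AEStronglyMeasurable.indicator ((hw.comp measurable_snd).aestronglyMeasurable.mul hh.comp_fst)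
      (measurableSet_lt measurable_snd measurable_fst)
  have e1 : ∀ s, (fun τ => F (s, τ)) = (Iio s).indicator fun τ => w τ * h s := fun s => by
    ext τ; simp [hF, indicator]
  have e2 : ∀ τ, (fun s => F (s, τ)) = (Ioi τ).indicator fun s => w τ * h s := fun τ => by
    ext s; simp [hF, indicator]
  have hs1 : ∀ s ∈ Ioo 0 T, Ioo 0 T ∩ Iio s = Ioo 0 s := fun s hs => by
    ext τ; simp only [mem_inter_iff, mem_Ioo, mem_Iio]
    exact ⟨fun h => ⟨h.1.1, h.2⟩, fun h => ⟨⟨h.1, h.2.trans hs.2⟩, h.2⟩⟩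
  have hs2 : ∀ τ ∈ Ioo 0 T, Ioo 0 T ∩ Ioi τ = Ioo τ T := fun τ hτ => by
    ext s; simp only [mem_inter_iff, mem_Ioo, mem_Ioi]
    exact ⟨fun h => ⟨h.2, h.1.2⟩, fun h => ⟨⟨hτ.1.trans h.1, h.2⟩, h.1⟩⟩
  have hint : Integrable F ((volume.restrict (Ioo 0 T)).prod (volume.restrict (Ioo 0 T))) := by
    rw [integrable_prod_iff hm]
    constructor
    · refine (ae_restrict_mem measurableSet_Ioo).mono fun s hs => ?_
      rw [e1, integrable_indicator_iff measurableSet_Iio, IntegrableOn,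
        Measure.restrict_restrict measurableSet_Iio, inter_comm, hs1 s hs]
      exact (h1 s hs).mul_const _
    · refine IntegrableOn.congr_fun h2 (fun s hs => ?_) measurableSet_Ioo
      have e3 : (fun τ => ‖F (s, τ)‖) = (Iio s).indicator fun τ => ‖w τ‖ * ‖h s‖ := by
        ext τ
        rw [congrFun (e1 s) τ, norm_indicator_eq_indicator_norm]
        simp only [norm_mul]
      rw [e3, setIntegral_indicator measurableSet_Iio, hs1 s hs, integral_mul_const,
        Real.norm_of_nonneg (hh0 s hs)]
      congr 1
      refine setIntegral_congr_fun measurableSet_Ioo fun τ hτ => ?_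
      exact (Real.norm_of_nonneg (hw0 τ ⟨hτ.1, hτ.2.trans hs.2⟩)).symm
  refine IntegrableOn.congr_fun hint.integral_prod_right (fun τ hτ => ?_) measurableSet_Ioo
  rw [e2, setIntegral_indicator measurableSet_Ioi, hs2 τ hτ, integral_const_mul]

/-- A nonzero limit would make 1/t integrable at 0. -/
theorem eq_zero_of_tendsto_of_integrableOn_inv_smul {E : Type*} [NormedAddCommGroup E]
    [NormedSpace ℝ E] {p : ℝ → E} {L : E}
    (hp : Tendsto p (𝓝[>] 0) (𝓝 L)) (hi : IntegrableOn (fun t : ℝ => t⁻¹ • p t) (Ioc 0 1)) :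
    L = 0 := by
  by_contra hL
  have hL0 : 0 < ‖L‖ := norm_pos_iff.2 hL
  have h1 : ∀ᶠ t in 𝓝[>] (0 : ℝ), ‖L‖ / 2 < ‖p t‖ :=
    hp.norm.eventually (lt_mem_nhds (by linarith))
  obtain ⟨ε, hε, hsub⟩ := mem_nhdsGT_iff_exists_Ioo_subset.1 h1
  have hε : 0 < ε := hε
  set d := min (ε / 2) 1 with hd
  have hd0 : 0 < d := lt_min (by linarith) one_pos
  have h2 : IntegrableOn (fun t : ℝ => t⁻¹) (Ioc 0 d) := by
    refine Integrable.mono' ((hi.mono_set (Ioc_subset_Ioc_right (min_le_right _ _))).norm.const_mul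
      (2 / ‖L‖)) (by fun_prop) ?_
    refine (ae_restrict_mem measurableSet_Ioc).mono fun t ht => ?_
    have h3 : ‖L‖ / 2 < ‖p t‖ := hsub ⟨ht.1, by linarith [ht.2, min_le_left (ε / 2) 1]⟩
    have ht0 : 0 < t⁻¹ := inv_pos.2 ht.1
    rw [norm_smul, Real.norm_of_nonneg ht0.le, div_mul_eq_mul_div, le_div_iff₀ hL0]
    nlinarith
  rw [← intervalIntegrable_iff_integrableOn_Ioc_of_le hd0.le, intervalIntegrable_inv_iff] at h2
  rcases h2 with h2 | h2
  · exact hd0.ne h2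
  · exact h2 (by simp [hd0.le])

end Tail

/-! ### The range of I^b. -/

section FractionalDerivative

variable {𝕜 : Type*} [RCLike 𝕜] {g f : ℝ → 𝕜} {b : ℝ}

/-- The difference p - I^1 g is constant, so p has a limit at 0; integrability of p/t forces this
limit, the constant, to vanish. -/
theorem eq_rlIntegral_one_of_integrableOn_inv_smul {p : ℝ → 𝕜} (hg : ContIntegrable g)
    (hp : ∀ t, 0 < t → HasDerivAt p (g t) t)
    (hi : IntegrableOn (fun t : ℝ => t⁻¹ • p t) (Ioc 0 1)) {t : ℝ} (ht : 0 < t) :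
    p t = rlIntegral 1 g t := by
  have h1 : ∀ s, 0 < s → p s = (p 1 - rlIntegral 1 g 1) + rlIntegral 1 g s := fun s hs => by
    rw [rlIntegral_one, rlIntegral_one]
    have h2 := intervalIntegral.integral_eq_sub_of_hasDerivAt (f := p) (f' := g) (a := 1) (b := s)
      (fun x hx => hp x (lt_of_lt_of_le (lt_min one_pos hs) hx.1))
      (hg.intervalIntegrable' zero_le_one hs.le)
    have h3 := intervalIntegral.integral_add_adjacent_intervals
      (hg.intervalIntegrable zero_le_one) (hg.intervalIntegrable' zero_le_one hs.le)
    rw [← h3, h2]; ring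
  have hL : Tendsto p (𝓝[>] 0) (𝓝 (p 1 - rlIntegral 1 g 1)) := by
    have h2 := hg.tendsto_rlIntegral_one.const_add (p 1 - rlIntegral 1 g 1)
    rw [add_zero] at h2
    exact h2.congr' (eventually_nhdsWithin_of_forall fun s hs => (h1 s hs).symm)
  have h0 := eq_zero_of_tendsto_of_integrableOn_inv_smul hL hi
  rw [h1 t ht, h0, zero_add]

/-- Write t = τ + (t - τ); the factor t - τ raises the order by one, and Γ(α+1) = αΓ(α). -/
theorem smul_rlIntegral {α t : ℝ} (hα : 0 < α) (ht : 0 < t) (hg : ContIntegrable g) :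
    t • rlIntegral α g t
      = rlIntegral α (fun τ => τ • g τ) t + α • rlIntegral (α + 1) g t := by
  have hm : ContIntegrable fun τ : ℝ => τ • g τ := hg.continuousOn_smul continuousOn_id
  have hα1 : 0 < α + 1 := by linarith
  have hΓ := (Real.Gamma_pos_of_pos hα).ne'
  have e : ∫ τ in Ioo 0 t, (t - τ) ^ (α + 1 - 1) • g τ
      = t • (∫ τ in Ioo 0 t, (t - τ) ^ (α - 1) • g τ)
        - ∫ τ in Ioo 0 t, (t - τ) ^ (α - 1) • (τ • g τ) := by
    have hi : IntegrableOn (fun τ => t • (t - τ) ^ (α - 1) • g τ) (Ioo 0 t) :=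
      (hg.kernel hα ht).smul t
    rw [← integral_smul, ← integral_sub hi (hm.kernel hα ht)]
    refine setIntegral_congr_fun measurableSet_Ioo fun τ hτ => ?_
    have h0 : t - τ ≠ 0 := by linarith [hτ.2]
    simp only [smul_smul]
    rw [← sub_smul]
    congr 1
    rw [show α + 1 - 1 = (α - 1) + 1 by ring, Real.rpow_add_one h0]
    ring
  rw [rlIntegral_of_pos hα _ ht, rlIntegral_of_pos hα _ ht, rlIntegral_of_pos hα1 _ ht, e,
    Real.Gamma_add_one hα.ne', smul_smul α, show α * (1 / (α * Real.Gamma α)) = 1 / Real.Gamma α by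
      field_simp, smul_sub, smul_comm t]
  abel

/-- Cut at s = 2τ. Below, s⁻¹ ≤ τ⁻¹ and b < 1 gives convergence at τ; above, s - τ ≥ s/2 and b > 0
gives convergence at infinity. The bound does not depend on t. -/
theorem setIntegral_inv_mul_sub_rpow_le {τ t : ℝ} (hb : 0 < b) (hb1 : b < 1) (hτ : 0 < τ) :
    IntegrableOn (fun s : ℝ => s⁻¹ * (s - τ) ^ (-b)) (Ioo τ t) ∧
    ∫ s in Ioo τ t, ‖s⁻¹ * (s - τ) ^ (-b)‖ ≤ (1 / (1 - b) + 1 / b) * τ ^ (-b) := by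
  have hb1' : 0 < 1 - b := by linarith
  have h2τ : τ ≤ 2 * τ := by linarith
  have hi1 : IntegrableOn (fun s : ℝ => τ⁻¹ * (s - τ) ^ (-b)) (Ioc τ (2 * τ)) := by
    have := ((intervalIntegral.intervalIntegrable_rpow' (a := 0) (b := τ) (r := -b)
      (by linarith)).comp_sub_right τ).const_mul τ⁻¹
    rw [zero_add, ← two_mul] at this
    exact (intervalIntegrable_iff_integrableOn_Ioc_of_le h2τ).1 this
  have hv1 : ∫ s in Ioc τ (2 * τ), τ⁻¹ * (s - τ) ^ (-b) = 1 / (1 - b) * τ ^ (-b) := by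
    rw [← intervalIntegral.integral_of_le h2τ, intervalIntegral.integral_const_mul,
      intervalIntegral.integral_comp_sub_right (fun x => x ^ (-b)), integral_rpow
      (Or.inl (by linarith)), sub_self, show 2 * τ - τ = τ by ring,
      Real.zero_rpow (by linarith), Real.rpow_add_one hτ.ne', show -b + 1 = 1 - b by ring]
    field_simp
    ring
  have hi2 : IntegrableOn (fun s : ℝ => 2 ^ b * s ^ (-1 - b)) (Ioi (2 * τ)) :=
    (integrableOn_Ioi_rpow_of_lt (by linarith) (by linarith)).const_mul _
  have hv2 : ∫ s in Ioi (2 * τ), (2 : ℝ) ^ b * s ^ (-1 - b) = 1 / b * τ ^ (-b) := by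
    rw [integral_const_mul, integral_Ioi_rpow_of_lt (by linarith) (by linarith),
      show -1 - b + 1 = -b by ring, Real.mul_rpow (by norm_num) hτ.le, Real.rpow_neg (by norm_num)]
    have : (2 : ℝ) ^ b ≠ 0 := (Real.rpow_pos_of_pos (by norm_num) _).ne'
    field_simp
  have hm : ∀ S : Set ℝ, AEStronglyMeasurable (fun s : ℝ => s⁻¹ * (s - τ) ^ (-b))
      (volume.restrict S) := fun S =>
    (by fun_prop : Measurable fun s : ℝ => s⁻¹ * (s - τ) ^ (-b)).aestronglyMeasurable
  have hle1 : ∀ s ∈ Ioc τ (2 * τ), ‖s⁻¹ * (s - τ) ^ (-b)‖ ≤ τ⁻¹ * (s - τ) ^ (-b) := fun s hs => by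
    have h0 : 0 ≤ s - τ := by linarith [hs.1]
    have hs0 : 0 < s := hτ.trans hs.1
    rw [Real.norm_of_nonneg (by positivity)]
    have := hs.1.le
    gcongr
  have hle2 : ∀ s ∈ Ioi (2 * τ), ‖s⁻¹ * (s - τ) ^ (-b)‖ ≤ 2 ^ b * s ^ (-1 - b) := fun s hs => by
    have hs : 2 * τ < s := hs
    have hs0 : 0 < s := by linarith
    have h0 : 0 < s - τ := by linarith
    rw [Real.norm_of_nonneg (by positivity)]
    have h1 : (s - τ) ^ (-b) ≤ (s / 2) ^ (-b) :=
      Real.rpow_le_rpow_of_nonpos (by positivity) (by linarith) (by linarith)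
    calc s⁻¹ * (s - τ) ^ (-b) ≤ s⁻¹ * (s / 2) ^ (-b) := by gcongr
      _ = _ := by
        rw [Real.div_rpow hs0.le (by norm_num), Real.rpow_neg (by norm_num : (0 : ℝ) ≤ 2),
          div_inv_eq_mul, show (-1 - b : ℝ) = -1 + -b by ring, Real.rpow_add hs0,
          Real.rpow_neg_one]
        ring
  have hk1 : IntegrableOn (fun s : ℝ => s⁻¹ * (s - τ) ^ (-b)) (Ioc τ (2 * τ)) :=
    Integrable.mono' hi1 (hm _) ((ae_restrict_mem measurableSet_Ioc).mono hle1)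
  have hk2 : IntegrableOn (fun s : ℝ => s⁻¹ * (s - τ) ^ (-b)) (Ioi (2 * τ)) :=
    Integrable.mono' hi2 (hm _) ((ae_restrict_mem measurableSet_Ioi).mono hle2)
  have hsub : Ioo τ t ⊆ Ioc τ (2 * τ) ∪ Ioi (2 * τ) := by
    rw [Ioc_union_Ioi_eq_Ioi h2τ]; exact Ioo_subset_Ioi_self
  refine ⟨(hk1.union hk2).mono_set hsub, ?_⟩
  calc ∫ s in Ioo τ t, ‖s⁻¹ * (s - τ) ^ (-b)‖
      ≤ ∫ s in Ioc τ (2 * τ) ∪ Ioi (2 * τ), ‖s⁻¹ * (s - τ) ^ (-b)‖ :=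
        setIntegral_mono_set (hk1.union hk2).norm (Eventually.of_forall fun _ => norm_nonneg _)
          hsub.eventuallyLE
    _ = (∫ s in Ioc τ (2 * τ), ‖s⁻¹ * (s - τ) ^ (-b)‖)
        + ∫ s in Ioi (2 * τ), ‖s⁻¹ * (s - τ) ^ (-b)‖ :=
        setIntegral_union (Ioc_disjoint_Ioi le_rfl) measurableSet_Ioi hk1.norm hk2.norm
    _ ≤ 1 / (1 - b) * τ ^ (-b) + 1 / b * τ ^ (-b) := by
        rw [← hv1, ← hv2]
        exact add_le_add (setIntegral_mono_on hk1.norm hi1 measurableSet_Ioc hle1)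
          (setIntegral_mono_on hk2.norm hi2 measurableSet_Ioi hle2)
    _ = _ := by ring

/-- A Hardy-type inequality: by Tonelli, ∫ s⁻¹ |I^(1-b) g| is at most a constant times ∫ τ^(-b) |g|.
-/
theorem ContIntegrable.inv_smul_rlIntegral (hg : ContIntegrable g) (hb : 0 < b) (hb1 : b < 1)
    (hw : ContIntegrable fun τ => τ ^ (-b) • g τ) :
    ContIntegrable fun t => t⁻¹ • _root_.rlIntegral (1 - b) g t := by
  have hb1' : 0 < 1 - b := by linarith
  refine ⟨ContinuousOn.smul (continuousOn_inv₀.mono fun x hx => (ne_of_gt hx))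
    (hg.rlIntegral hb1'.le).continuousOn, fun T hT => ?_⟩
  rw [integrableOn_Ioc_iff_integrableOn_Ioo]
  have h1 := integrable_triangle (k := fun s τ => s⁻¹ * (s - τ) ^ (-b)) (t := T)
    (B := fun τ => (1 / (1 - b) + 1 / b) * τ ^ (-b)) (g := g)
    (by unfold Function.uncurry; fun_prop)
    ((hg.integrableOn T hT).mono_set Ioo_subset_Ioc_self).aestronglyMeasurable
    (fun τ hτ => (setIntegral_inv_mul_sub_rpow_le hb hb1 hτ.1).1)
    (fun τ hτ => (setIntegral_inv_mul_sub_rpow_le hb hb1 hτ.1).2) ?_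
  · refine IntegrableOn.congr_fun ((integrableOn_triangle
      (k := fun s τ => s⁻¹ * (s - τ) ^ (-b)) h1).smul (1 / Real.Gamma (1 - b)))
      (fun s hs => ?_) measurableSet_Ioo
    rw [rlIntegral_of_pos hb1' _ hs.1, smul_comm, ← integral_smul]
    simp only [Pi.smul_apply, smul_smul, show 1 - b - 1 = -b by ring]
  · refine IntegrableOn.congr_fun (((hw.integrableOn T hT).mono_set Ioo_subset_Ioc_self).norm.const_mul
      (1 / (1 - b) + 1 / b)) (fun τ hτ => ?_) measurableSet_Ioo
    rw [norm_smul, Real.norm_of_nonneg (Real.rpow_nonneg hτ.1.le _)]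
    ring

variable {f' : ℝ → 𝕜}

/-- Insert f(τ) = f(1) - ∫_τ^1 f' and swap: the weight τ^(-b) integrates over (0, s) to
s^(1-b)/(1-b), the weight assumed for f'. -/
theorem ContIntegrable.rpow_neg_smul_of_deriv (hf : ContIntegrable f)
    (hd : ∀ t, 0 < t → HasDerivAt f (f' t) t) (hf' : ContinuousOn f' (Ioi 0)) (hb1 : b < 1)
    (hw : ContIntegrable fun t => t ^ (1 - b) • f' t) :
    ContIntegrable fun t => t ^ (-b) • f t := by
  have hb1' : 0 < 1 - b := by linarith
  refine of_integrableOn_one ((continuousOn_rpow_const_Ioi _).smul hf.continuousOn) ?_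
  rw [integrableOn_Ioc_iff_integrableOn_Ioo]
  have hpow : ∀ s : ℝ, 0 < s → IntegrableOn (fun x : ℝ => x ^ (-b)) (Ioo 0 s) := fun s hs => by
    have := (contIntegrable_rpow hb1').integrableOn s hs
    rw [show 1 - b - 1 = -b by ring] at this
    exact this.mono_set Ioo_subset_Ioc_self
  have hval : ∀ s : ℝ, 0 < s → ∫ τ in Ioo 0 s, τ ^ (-b) = 1 / (1 - b) * s ^ (1 - b) := fun s hs => by
    rw [← integral_Ioc_eq_integral_Ioo, ← intervalIntegral.integral_of_le hs.le, integral_rpow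
      (Or.inl (by linarith)), show -b + 1 = 1 - b by ring, Real.zero_rpow hb1'.ne']
    ring
  have h1 := integrableOn_mul_integral_tail (w := fun τ => τ ^ (-b)) (h := fun s => ‖f' s‖)
    (T := 1) (by fun_prop) (fun τ hτ => Real.rpow_nonneg hτ.1.le _) (fun _ _ => norm_nonneg _)
    ((hf'.norm.mono Ioo_subset_Ioi_self).aestronglyMeasurable measurableSet_Ioo)
    (fun s hs => hpow s hs.1) ?_
  · refine Integrable.mono' (((hpow 1 one_pos).mul_const ‖f 1‖).add h1)
      (((continuousOn_rpow_const_Ioi _).smul hf.continuousOn).mono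
        Ioo_subset_Ioi_self |>.aestronglyMeasurable measurableSet_Ioo) ?_
    refine (ae_restrict_mem measurableSet_Ioo).mono fun τ hτ => ?_
    have hp : 0 ≤ τ ^ (-b) := Real.rpow_nonneg hτ.1.le _
    rw [norm_smul, Real.norm_of_nonneg hp, Pi.add_apply, ← mul_add]
    refine mul_le_mul_of_nonneg_left ?_ hp
    have hc : ContinuousOn f' (uIcc τ 1) := hf'.mono fun x hx => by
      rw [uIcc_of_le hτ.2.le] at hx
      exact hτ.1.trans_le hx.1
    have h2 := intervalIntegral.integral_eq_sub_of_hasDerivAt (f := f) (f' := f') (a := τ) (b := 1)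
      (fun x hx => by
        rw [uIcc_of_le hτ.2.le] at hx
        exact hd x (hτ.1.trans_le hx.1)) hc.intervalIntegrable
    have h3 : f τ = f 1 - ∫ s in τ..1, f' s := by rw [h2]; ring
    rw [h3]
    refine (norm_sub_le _ _).trans (add_le_add le_rfl ?_)
    rw [← integral_Ioc_eq_integral_Ioo, intervalIntegral.integral_of_le hτ.2.le]
    exact norm_integral_le_integral_norm _
  · refine IntegrableOn.congr_fun (((hw.integrableOn 1 one_pos).mono_set
      Ioo_subset_Ioc_self).norm.const_mul (1 / (1 - b))) (fun s hs => ?_) measurableSet_Ioo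
    rw [hval s hs.1, norm_smul, Real.norm_of_nonneg (Real.rpow_nonneg hs.1.le _)]
    ring

/-- A function with `∫ t^(1-b) |f'(t)| dt < ∞` near `0` is a fractional integral of order `b`. -/
theorem ContIntegrable.exists_rlIntegral_eq (hf : ContIntegrable f)
    (hd : ∀ t, 0 < t → HasDerivAt f (f' t) t) (hf' : ContinuousOn f' (Ioi 0))
    (hb : 0 < b) (hb1 : b < 1) (hw : ContIntegrable fun t => t ^ (1 - b) • f' t) :
    ∃ φ : ℝ → 𝕜, ContIntegrable φ ∧ EqOn (_root_.rlIntegral b φ) f (Ioi 0) := by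
  have hb1' : 0 < 1 - b := by linarith
  have hm : ContIntegrable fun t : ℝ => t • f' t := by
    refine (hw.continuousOn_smul (k := fun x : ℝ => x ^ b)
      (continuousOn_id.rpow_const fun _ _ => Or.inr hb.le)).congr fun t ht => ?_
    have ht : 0 < t := ht
    simp only
    rw [smul_smul, ← Real.rpow_add ht, show b + (1 - b) = 1 by ring, Real.rpow_one]
  have hwf := hf.rpow_neg_smul_of_deriv hd hf' hb1 hw
  -- For q = I^(1-b) f, differentiating t q = I^(1-b)(t f) + (1-b) I^(2-b) f gives t q' = I^(1-b) ψ;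
  -- hence the candidate φ = q' below.
  set ψ : ℝ → 𝕜 := fun t => ((1 - b : ℝ) : 𝕜) * f t + t • f' t with hψ
  have hψc : ContIntegrable ψ := (hf.const_mul _).add hm
  have hwψ : ContIntegrable fun t => t ^ (-b) • ψ t := by
    refine ((hwf.const_mul ((1 - b : ℝ) : 𝕜)).add hw).congr fun t ht => ?_
    have ht : 0 < t := ht
    simp only [hψ]
    rw [smul_add, smul_smul, ← Real.rpow_add_one ht.ne', mul_smul_comm,
      show -b + 1 = 1 - b by ring]
  have hφ := hψc.inv_smul_rlIntegral hb hb1 hwψ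
  set φ : ℝ → 𝕜 := fun t => t⁻¹ • _root_.rlIntegral (1 - b) ψ t with hφdef
  have hq := hf.rlIntegral hb1'.le
  set q := _root_.rlIntegral (1 - b) f with hqdef
  have hsum : ContIntegrable fun t => f t + t • f' t := hf.add hm
  -- There is no boundary term at 0, because t⁻¹(t f) = f is integrable there.
  have h1 : ∀ t, 0 < t → t • f t = _root_.rlIntegral 1 (fun t => f t + t • f' t) t := fun t ht => by
    refine eq_rlIntegral_one_of_integrableOn_inv_smul (p := fun t => t • f t) hsum
      (fun s hs => ?_) ?_ ht
    · have := (hasDerivAt_id s).smul (hd s hs)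
      simp only [id, one_smul] at this
      rwa [add_comm]
    · refine (hf.integrableOn 1 one_pos).congr_fun (fun s hs => ?_) measurableSet_Ioc
      rw [inv_smul_smul₀ hs.1.ne']
  have hN := (hf.add hψc).rlIntegral hb1'.le
  have h2 : ∀ t, 0 < t → t • q t
      = _root_.rlIntegral 1 (_root_.rlIntegral (1 - b) fun x => f x + ψ x) t := fun t ht => by
    rw [(hf.add hψc).rlIntegral_rlIntegral zero_le_one hb1'.le ht, hqdef,
      smul_rlIntegral hb1' ht hf,
      rlIntegral_congr (h := _root_.rlIntegral 1 fun t => f t + t • f' t) hb1'.le ht h1,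
      hsum.rlIntegral_rlIntegral hb1'.le zero_le_one ht, RCLike.real_smul_eq_coe_mul,
      ← rlIntegral_const_mul, ← rlIntegral_add (by linarith) ht hsum (hf.const_mul _), add_comm 1]
    congr 1
    ext x
    simp only [hψ]
    ring
  have h3 : ∀ t, 0 < t → HasDerivAt q (φ t) t := fun t ht => by
    have h4 := (hN.hasDerivAt_rlIntegral_one ht)
    have h5 := (hasDerivAt_inv ht.ne').smul h4
    have h6 : q =ᶠ[𝓝 t] (fun x : ℝ => x⁻¹) •
        _root_.rlIntegral 1 (_root_.rlIntegral (1 - b) fun x => f x + ψ x) := by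
      filter_upwards [Ioi_mem_nhds ht] with s hs
      have hs : 0 < s := hs
      rw [Pi.smul_apply', ← h2 s hs, inv_smul_smul₀ hs.ne']
    refine (h5.congr_of_eventuallyEq h6).congr_deriv ?_
    rw [← h2 t ht, rlIntegral_add hb1'.le ht hf hψc, smul_add, smul_smul, hφdef, hqdef,
      show -(t ^ 2)⁻¹ * t = -t⁻¹ by field_simp, neg_smul]
    abel
  have h4 : ∀ t, 0 < t → q t = _root_.rlIntegral 1 φ t := fun t ht =>
    eq_rlIntegral_one_of_integrableOn_inv_smul hφ h3
      ((hf.inv_smul_rlIntegral hb hb1 hwf).integrableOn 1 one_pos) ht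
  refine ⟨φ, hφ, ?_⟩
  -- Now I^(1-b) f = I^1 φ = I^(1-b) I^b φ, and I^(1-b) is injective.
  refine (hφ.rlIntegral hb.le).eqOn_of_rlIntegral_eq hf hb1'.le (by linarith) fun t ht => ?_
  rw [hφ.rlIntegral_rlIntegral hb1'.le hb.le ht, sub_add_cancel]
  exact (h4 t ht).symm

end FractionalDerivative

/-! ### Equivalence of the Cauchy problem and the Volterra equation. -/

section Cauchy

variable {𝕜 : Type*} [RCLike 𝕜] {f u w h : ℝ → 𝕜} {a b δ : ℝ} {lam ξ₀ ξ₁ : 𝕜}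

/-- The normalized power `t^(c-1) / Γ(c)`. -/
def gammaPower (𝕜 : Type*) [RCLike 𝕜] (c t : ℝ) : 𝕜 :=
  ((t ^ (c - 1) / Real.Gamma c : ℝ) : 𝕜)

theorem contIntegrable_gammaPower {c : ℝ} (hc : 0 < c) : ContIntegrable (gammaPower 𝕜 c) := by
  have h := contIntegrable_rpow hc
  refine ⟨?_, fun T hT => ?_⟩
  · exact RCLike.continuous_ofReal.comp_continuousOn (h.continuousOn.div_const _)
  · exact ((h.integrableOn T hT).div_const _).ofReal

theorem rlIntegral_gammaPower {α c t : ℝ} (hα : 0 ≤ α) (hc : 0 < c) (ht : 0 < t) :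
    rlIntegral α (gammaPower 𝕜 c) t = gammaPower 𝕜 (c + α) t :=
  rlIntegral_rpow hα hc ht

theorem gammaPower_one (t : ℝ) : gammaPower 𝕜 1 t = 1 := by simp [gammaPower]

theorem gammaPower_two (t : ℝ) : gammaPower 𝕜 2 t = (t : 𝕜) := by
  simp [gammaPower, show (2 : ℝ) - 1 = 1 by norm_num]

/-- `ξ₀ t^(c-1) / Γ(c) + ξ₁ t^c / Γ(c+1) + I^α h`. -/
def cauchyTerm (ξ₀ ξ₁ : 𝕜) (c α : ℝ) (h : ℝ → 𝕜) (t : ℝ) : 𝕜 :=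
  ξ₀ * gammaPower 𝕜 c t + ξ₁ * gammaPower 𝕜 (c + 1) t + rlIntegral α h t

theorem ContIntegrable.cauchyTerm {c α : ℝ} (hh : ContIntegrable h) (hc : 0 < c) (hα : 0 ≤ α) :
    ContIntegrable (cauchyTerm ξ₀ ξ₁ c α h) :=
  (((contIntegrable_gammaPower hc).const_mul _).add
    ((contIntegrable_gammaPower (by linarith)).const_mul _)).add (hh.rlIntegral hα)

/-- This stability lets c = 1 - a pass to c = 1, turning the Volterra right-hand side into a Taylor
formula for I^a u. -/
theorem ContIntegrable.rlIntegral_cauchyTerm {c α ν t : ℝ} (hh : ContIntegrable h) (hc : 0 < c)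
    (hα : 0 ≤ α) (hν : 0 ≤ ν) (ht : 0 < t) :
    _root_.rlIntegral ν (_root_.cauchyTerm ξ₀ ξ₁ c α h) t
      = _root_.cauchyTerm ξ₀ ξ₁ (c + ν) (ν + α) h t := by
  have h0 := (contIntegrable_gammaPower (𝕜 := 𝕜) hc).const_mul ξ₀
  have h1 := (contIntegrable_gammaPower (𝕜 := 𝕜) (c := c + 1) (by linarith)).const_mul ξ₁
  unfold _root_.cauchyTerm
  rw [rlIntegral_add hν ht (h0.add h1) (hh.rlIntegral hα), rlIntegral_add hν ht h0 h1,
    rlIntegral_const_mul, rlIntegral_const_mul, rlIntegral_gammaPower hν hc ht,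
    rlIntegral_gammaPower hν (by linarith) ht, hh.rlIntegral_rlIntegral hν hα ht,
    add_right_comm c 1 ν]

theorem ContIntegrable.hasSum_cauchyTerm (hf : ContIntegrable f) {c t : ℝ} (hδ : 1 ≤ δ)
    (hc : 0 < c) (ht : 0 < t) :
    HasSum (fun k : ℕ => (-lam) ^ k *
        _root_.rlIntegral (δ * k) (_root_.cauchyTerm ξ₀ ξ₁ c δ f) t)
      (ξ₀ * (((t ^ (c - 1) : ℝ) : 𝕜) * mittagLeffler δ c (-lam * ((t ^ δ : ℝ) : 𝕜)))
        + ξ₁ * (((t ^ (c + 1 - 1) : ℝ) : 𝕜)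
          * mittagLeffler δ (c + 1) (-lam * ((t ^ δ : ℝ) : 𝕜)))
        + ∫ τ in (0 : ℝ)..t, (((t - τ) ^ (δ - 1) : ℝ) : 𝕜)
          * mittagLeffler δ δ (-lam * (((t - τ) ^ δ : ℝ) : 𝕜)) * f τ) := by
  have h0 := (hasSum_mittagLeffler lam hδ hc ht).mul_left ξ₀
  have h1 := (hasSum_mittagLeffler lam hδ (show 0 < c + 1 by linarith) ht).mul_left ξ₁
  refine ((h0.add h1).add (hf.hasSum_rlIntegral_add (lam := lam) hδ ht)).congr_fun fun k => ?_
  rw [hf.rlIntegral_cauchyTerm hc (by linarith) (by positivity) ht, _root_.cauchyTerm, gammaPower,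
    gammaPower, add_right_comm c 1]
  ring

theorem hilferCauchyFormula_eq {γ β μ t : ℝ} (hf : ContIntegrable f)
    (hδ : 1 ≤ β + μ * (γ - β)) (ha : (1 - μ) * (2 - β) < 1) (ht : 0 < t) :
    hilferCauchyFormula γ β μ lam ξ₀ ξ₁ f t
      = volterraResolvent (β + μ * (γ - β)) lam
        (cauchyTerm ξ₀ ξ₁ (1 - (1 - μ) * (2 - β)) (β + μ * (γ - β)) f) t := by
  rw [volterraResolvent,
    (hf.hasSum_cauchyTerm (c := 1 - (1 - μ) * (2 - β)) hδ (by linarith) ht).tsum_eq]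
  simp only [hilferCauchyFormula]
  rw [show (β - 2) * (1 - μ) = 1 - (1 - μ) * (2 - β) - 1 by ring,
    show β + μ * (γ - β) + μ * (2 - γ) - 1 = 1 - (1 - μ) * (2 - β) by ring,
    show β + μ * (γ - β) + μ * (2 - γ) = 1 - (1 - μ) * (2 - β) + 1 by ring,
    show μ + (β - 1) * (1 - μ) = 1 - (1 - μ) * (2 - β) + 1 - 1 by ring]
  ring

theorem hasDerivAt_of_contDiffOn_two {v : ℝ → 𝕜} (hv : ContDiffOn ℝ 2 v (Ioi 0)) {t : ℝ}
    (ht : 0 < t) :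
    HasDerivAt v (deriv v t) t ∧ HasDerivAt (deriv v) (iteratedDeriv 2 v t) t := by
  have h1 : ContDiffOn ℝ 1 (deriv v) (Ioi 0) := hv.deriv_of_isOpen isOpen_Ioi (by norm_num)
  refine ⟨((hv.differentiableOn (by norm_num)).differentiableAt (Ioi_mem_nhds ht)).hasDerivAt, ?_⟩
  rw [iteratedDeriv_succ, iteratedDeriv_one]
  exact ((h1.differentiableOn (by norm_num)).differentiableAt (Ioi_mem_nhds ht)).hasDerivAt

theorem continuousOn_iteratedDeriv_two {v : ℝ → 𝕜} (hv : ContDiffOn ℝ 2 v (Ioi 0)) :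
    ContinuousOn (iteratedDeriv 2 v) (Ioi 0) := by
  have h1 : ContDiffOn ℝ 1 (deriv v) (Ioi 0) := hv.deriv_of_isOpen isOpen_Ioi (by norm_num)
  rw [iteratedDeriv_succ, iteratedDeriv_one]
  exact h1.continuousOn_deriv_of_isOpen isOpen_Ioi (by norm_num)

/-- Taylor's formula at `0` with initial values taken as limits. -/
theorem eq_cauchyTerm_of_tendsto {v : ℝ → 𝕜} (hv : ContDiffOn ℝ 2 v (Ioi 0))
    (hw : ContIntegrable (iteratedDeriv 2 v)) (h0 : Tendsto v (𝓝[>] 0) (𝓝 ξ₀))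
    (h1 : Tendsto (deriv v) (𝓝[>] 0) (𝓝 ξ₁)) {t : ℝ} (ht : 0 < t) :
    v t = cauchyTerm ξ₀ ξ₁ 1 2 (iteratedDeriv 2 v) t := by
  have hd := fun s hs => eq_add_rlIntegral_one hw
    (fun t ht => (hasDerivAt_of_contDiffOn_two hv ht).2) h1 (t := s) hs
  have hc1 := (contIntegrable_gammaPower (𝕜 := 𝕜) one_pos).const_mul ξ₁
  have hw1 := hw.rlIntegral zero_le_one
  have he : EqOn (fun s => ξ₁ * gammaPower 𝕜 1 s + rlIntegral 1 (iteratedDeriv 2 v) s) (deriv v)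
      (Ioi 0) := fun s hs => by simp only [gammaPower_one, mul_one]; exact (hd s hs).symm
  have hdc : ContIntegrable (deriv v) := (hc1.add hw1).congr he
  rw [eq_add_rlIntegral_one hdc (fun t ht => (hasDerivAt_of_contDiffOn_two hv ht).1) h0 ht,
    ← rlIntegral_congr zero_le_one ht he, rlIntegral_add zero_le_one ht hc1 hw1,
    rlIntegral_const_mul, rlIntegral_gammaPower zero_le_one one_pos ht,
    hw.rlIntegral_rlIntegral zero_le_one zero_le_one ht, cauchyTerm, gammaPower_one, mul_one,
    show (1 : ℝ) + 1 = 2 by norm_num, add_assoc]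

theorem ContIntegrable.volterra_cauchyTerm_iff (hf : ContIntegrable f) (hu : ContIntegrable u)
    {c t : ℝ} (hδ : 0 ≤ δ) (ht : 0 < t) :
    u t + lam * _root_.rlIntegral δ u t = _root_.cauchyTerm ξ₀ ξ₁ c δ f t ↔
      u t = _root_.cauchyTerm ξ₀ ξ₁ c δ (fun x => f x - lam * u x) t := by
  unfold _root_.cauchyTerm
  rw [rlIntegral_sub hδ ht hf (hu.const_mul lam), rlIntegral_const_mul, ← eq_sub_iff_add_eq,
    add_sub_assoc]

/-- Solutions satisfy the Volterra equation of the problem. -/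
theorem volterra_of_equation (hf : ContIntegrable f) (hu : ContIntegrable u) (ha : 0 ≤ a)
    (ha1 : a < 1) (hb : 0 ≤ b) (hδ : 0 ≤ δ) (hab : a + b + δ = 2)
    (hv : ContDiffOn ℝ 2 (rlIntegral a u) (Ioi 0))
    (hw : ContIntegrable (iteratedDeriv 2 (rlIntegral a u)))
    (heq : ∀ t, 0 < t → rlIntegral b (iteratedDeriv 2 (rlIntegral a u)) t + lam * u t = f t)
    (h0 : Tendsto (rlIntegral a u) (𝓝[>] 0) (𝓝 ξ₀))
    (h1 : Tendsto (deriv (rlIntegral a u)) (𝓝[>] 0) (𝓝 ξ₁)) {t : ℝ} (ht : 0 < t) :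
    u t + lam * rlIntegral δ u t = cauchyTerm ξ₀ ξ₁ (1 - a) δ f t := by
  have hh := hf.sub (hu.const_mul lam)
  have hc : 0 < 1 - a := by linarith
  rw [hf.volterra_cauchyTerm_iff hu hδ ht]
  -- Since a ≤ 1, it suffices to compare after applying I^a; there both sides are the Taylor
  -- formula, as a + δ + b = 2.
  refine hu.eqOn_of_rlIntegral_eq (hh.cauchyTerm hc hδ) ha ha1.le (fun s hs => ?_) ht
  have hs : 0 < s := hs
  have e : EqOn (rlIntegral b (iteratedDeriv 2 (rlIntegral a u))) (fun x => f x - lam * u x)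
      (Ioi 0) := fun x hx => eq_sub_of_add_eq (heq x hx)
  rw [hh.rlIntegral_cauchyTerm hc hδ ha hs, eq_cauchyTerm_of_tendsto hv hw h0 h1 hs,
    sub_add_cancel, cauchyTerm, cauchyTerm, ← rlIntegral_congr (by linarith) hs e,
    hw.rlIntegral_rlIntegral (by linarith) hb hs, show a + δ + b = 2 by linarith]

/-- The right-hand side and a solution of the Volterra equation are in the range of `I^b`. -/
theorem exists_rlIntegral_eq_sub (hf : ContIntegrable f) (hu : ContIntegrable u) (hab1 : a + b < 1)
    (hb : 0 ≤ b) (hbδ : b ≤ δ)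
    (hF : ∃ φ : ℝ → 𝕜, ContIntegrable φ ∧ EqOn (rlIntegral b φ) f (Ioi 0))
    (he : EqOn u (cauchyTerm ξ₀ ξ₁ (1 - a) δ fun x => f x - lam * u x) (Ioi 0)) :
    ∃ w : ℝ → 𝕜, ContIntegrable w ∧ EqOn (rlIntegral b w) (fun x => f x - lam * u x) (Ioi 0) := by
  obtain ⟨φ, hφ, hφf⟩ := hF
  have hh := hf.sub (hu.const_mul lam)
  have hc : 0 < 1 - a - b := by linarith
  -- Lowering both parameters of u's representation by b gives y with I^b y = u; the witness is φ -
  -- λy.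
  have hy := hh.cauchyTerm (ξ₀ := ξ₀) (ξ₁ := ξ₁) hc (sub_nonneg.2 hbδ)
  refine ⟨_, hφ.sub (hy.const_mul lam), fun t ht => ?_⟩
  have ht : 0 < t := ht
  rw [rlIntegral_sub hb ht hφ (hy.const_mul lam), rlIntegral_const_mul,
    hh.rlIntegral_cauchyTerm hc (sub_nonneg.2 hbδ) hb ht, hφf ht, sub_add_cancel, add_sub_cancel,
    ← he ht]

theorem eqOn_taylor_of_eqOn_cauchyTerm (hw : ContIntegrable w)
    {v : ℝ → 𝕜} (hv : EqOn v (cauchyTerm ξ₀ ξ₁ 1 2 w) (Ioi 0)) :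
    EqOn v (fun t => ξ₀ + ξ₁ * (t : 𝕜) + rlIntegral 1 (rlIntegral 1 w) t) (Ioi 0) := fun t ht => by
  simp only
  rw [hv ht, cauchyTerm, gammaPower_one, mul_one, hw.rlIntegral_rlIntegral zero_le_one zero_le_one ht,
    show (1 : ℝ) + 1 = 2 by norm_num, gammaPower_two]

theorem contDiffOn_of_eqOn_cauchyTerm (hw : ContIntegrable w) {v : ℝ → 𝕜}
    (hv : EqOn v (cauchyTerm ξ₀ ξ₁ 1 2 w) (Ioi 0)) :
    ContDiffOn ℝ 2 v (Ioi 0) ∧ EqOn (deriv v) (fun t => ξ₁ + rlIntegral 1 w t) (Ioi 0) ∧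
      EqOn (iteratedDeriv 2 v) w (Ioi 0) := by
  have hw1 := hw.rlIntegral zero_le_one
  have e := eqOn_taylor_of_eqOn_cauchyTerm hw hv
  have hd1 : ∀ t, 0 < t → HasDerivAt v (ξ₁ + rlIntegral 1 w t) t := fun t ht => by
    have h1 : HasDerivAt (fun t : ℝ => (t : 𝕜)) 1 t := by
      simpa using (RCLike.ofRealCLM (K := 𝕜)).hasDerivAt (x := t)
    have h2 := ((h1.const_mul ξ₁).const_add ξ₀).add (hw1.hasDerivAt_rlIntegral_one ht)
    rw [mul_one] at h2
    exact h2.congr_of_eventuallyEq (e.eventuallyEq_of_mem (Ioi_mem_nhds ht))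
  have ed : EqOn (deriv v) (fun t => ξ₁ + rlIntegral 1 w t) (Ioi 0) := fun t ht => (hd1 t ht).deriv
  have hd2 : ∀ t, 0 < t → HasDerivAt (deriv v) (w t) t := fun t ht =>
    ((hw.hasDerivAt_rlIntegral_one ht).const_add ξ₁).congr_of_eventuallyEq
      (ed.eventuallyEq_of_mem (Ioi_mem_nhds ht))
  have edd : EqOn (deriv (deriv v)) w (Ioi 0) := fun t ht => (hd2 t ht).deriv
  refine ⟨?_, ed, ?_⟩
  · rw [show (2 : WithTop ℕ∞) = 1 + 1 by norm_num, contDiffOn_succ_iff_deriv_of_isOpen isOpen_Ioi]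
    refine ⟨fun t ht => (hd1 t ht).differentiableAt.differentiableWithinAt, by simp, ?_⟩
    rw [show (1 : WithTop ℕ∞) = 0 + 1 by norm_num, contDiffOn_succ_iff_deriv_of_isOpen isOpen_Ioi]
    refine ⟨fun t ht => (hd2 t ht).differentiableAt.differentiableWithinAt, by simp, ?_⟩
    exact contDiffOn_zero.2 (hw.continuousOn.congr edd)
  · rw [iteratedDeriv_succ, iteratedDeriv_one]
    exact edd

theorem tendsto_of_eqOn_cauchyTerm (hw : ContIntegrable w) {v : ℝ → 𝕜}
    (hv : EqOn v (cauchyTerm ξ₀ ξ₁ 1 2 w) (Ioi 0)) :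
    Tendsto v (𝓝[>] 0) (𝓝 ξ₀) ∧ Tendsto (deriv v) (𝓝[>] 0) (𝓝 ξ₁) := by
  have hw1 := hw.rlIntegral zero_le_one
  have e := eqOn_taylor_of_eqOn_cauchyTerm hw hv
  constructor
  · have h1 : Tendsto (fun t : ℝ => ξ₀ + ξ₁ * (t : 𝕜)) (𝓝[>] 0) (𝓝 (ξ₀ + ξ₁ * ((0 : ℝ) : 𝕜))) :=
      (by fun_prop : Continuous fun t : ℝ => ξ₀ + ξ₁ * (t : 𝕜)).continuousAt.mono_left
        nhdsWithin_le_nhds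
    have h2 := h1.add hw1.tendsto_rlIntegral_one
    simp only [RCLike.ofReal_zero, mul_zero, add_zero] at h2
    exact h2.congr' (eventually_nhdsWithin_of_forall fun t ht => (e ht).symm)
  · have h2 := hw.tendsto_rlIntegral_one.const_add ξ₁
    rw [add_zero] at h2
    exact h2.congr' (eventually_nhdsWithin_of_forall fun t ht =>
      ((contDiffOn_of_eqOn_cauchyTerm hw hv).2.1 ht).symm)

end Cauchy

end

/-! ### Assembly of uniqueness and existence. -/

theorem theorem2p2 {𝕜 : Type*} [RCLike 𝕜] (γ β μ : ℝ)
    (hγ : 1 < γ) (hγ' : γ ≤ 2) (hβ : 1 < β) (hβ' : β ≤ 2) (hμ : 0 ≤ μ) (hμ' : μ ≤ 1)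
    (lam ξ₀ ξ₁ : 𝕜) (f : ℝ → 𝕜)
    (hf : ContDiffOn ℝ 1 f (Ioi 0)) (hfint : IntegrableOn f (Ioc 0 1)) :
    (∀ u : ℝ → 𝕜, IsHilferCauchySolution γ β μ lam ξ₀ ξ₁ f u →
      ∀ t : ℝ, 0 < t → u t = hilferCauchyFormula γ β μ lam ξ₀ ξ₁ f t) ∧
    ((μ * (2 - γ) = 0 ∨
        IntegrableOn (fun t : ℝ => t ^ (1 - μ * (2 - γ)) • deriv f t) (Ioc 0 1)) →
      IsHilferCauchySolution γ β μ lam ξ₀ ξ₁ f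
        (hilferCauchyFormula γ β μ lam ξ₀ ξ₁ f)) := by
  have hfc : ContIntegrable f := .of_integrableOn_one hf.continuousOn hfint
  have ha : 0 ≤ (1 - μ) * (2 - β) := mul_nonneg (by linarith) (by linarith)
  have hb : 0 ≤ μ * (2 - γ) := mul_nonneg hμ (by linarith)
  have hδ : 1 < β + μ * (γ - β) := by
    rcases hμ.eq_or_lt with rfl | hμ0
    · linarith
    · nlinarith [mul_pos hμ0 (sub_pos.2 hγ), mul_nonneg (sub_nonneg.2 hμ') (sub_pos.2 hβ).le]
  have hsum : (1 - μ) * (2 - β) + μ * (2 - γ) + (β + μ * (γ - β)) = 2 := by ring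
  have hformula := fun t ht => hilferCauchyFormula_eq (γ := γ) (β := β) (μ := μ) (lam := lam)
    (ξ₀ := ξ₀) (ξ₁ := ξ₁) (t := t) hfc hδ.le (by linarith) ht
  have hc : 0 < 1 - (1 - μ) * (2 - β) := by linarith
  have hG := hfc.cauchyTerm (ξ₀ := ξ₀) (ξ₁ := ξ₁) hc (by linarith : 0 ≤ β + μ * (γ - β))
  constructor
  · intro u hu t ht
    have huc : ContIntegrable u := ⟨hu.continuousOn, hu.integrableOn⟩
    rw [hformula t ht]
    refine eqOn_volterraResolvent hG huc hδ.le (fun s hs => ?_) ht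
    refine volterra_of_equation hfc huc ha (by linarith) hb (by linarith) hsum hu.contDiffOn
      ⟨continuousOn_iteratedDeriv_two hu.contDiffOn, hu.integrableOn_deriv2⟩ (fun r hr => ?_)
      hu.initial_zero hu.initial_one hs
    simpa [hilferDeriv] using hu.equation r hr
  · intro hcond
    have hF : ∃ φ : ℝ → 𝕜, ContIntegrable φ ∧
        EqOn (rlIntegral (μ * (2 - γ)) φ) f (Ioi 0) := by
      rcases hb.eq_or_lt with hb0 | hb0
      -- For b = 0 the operator I^b is the identity, so no condition on f' is needed.
      · exact ⟨f, hfc, by rw [← hb0, rlIntegral_zero]; exact fun _ _ => rfl⟩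
      have hw := hcond.resolve_left hb0.ne'
      have hd := hf.continuousOn_deriv_of_isOpen isOpen_Ioi le_rfl
      exact hfc.exists_rlIntegral_eq
        (fun t ht => ((hf.differentiableOn one_ne_zero).differentiableAt
          (Ioi_mem_nhds ht)).hasDerivAt) hd hb0 (by linarith)
        (.of_integrableOn_one ((continuousOn_rpow_const_Ioi _).smul hd) hw)
    have heR : EqOn (volterraResolvent (β + μ * (γ - β)) lam
        (cauchyTerm ξ₀ ξ₁ (1 - (1 - μ) * (2 - β)) (β + μ * (γ - β)) f))
        (hilferCauchyFormula γ β μ lam ξ₀ ξ₁ f) (Ioi 0) := fun t ht => (hformula t ht).symm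
    set u := hilferCauchyFormula γ β μ lam ξ₀ ξ₁ f with hu
    have huc : ContIntegrable u := (hG.volterraResolvent hδ.le).congr heR
    have hδ0 : 0 ≤ β + μ * (γ - β) := by linarith
    have he : EqOn u (cauchyTerm ξ₀ ξ₁ (1 - (1 - μ) * (2 - β)) (β + μ * (γ - β))
        fun x => f x - lam * u x) (Ioi 0) := fun t ht => by
      rw [← hfc.volterra_cauchyTerm_iff huc hδ0 ht, ← heR ht, ← rlIntegral_congr hδ0 ht heR]
      exact hG.volterraResolvent_add hδ.le ht
    obtain ⟨w, hw, hwe⟩ := exists_rlIntegral_eq_sub hfc huc (by linarith) hb (by linarith) hF he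
    -- I^a u = ξ₀ + ξ₁ t + I^(a+δ) I^b w with a + δ + b = 2: regularity, both limits and w as second
    -- derivative are read off from this.
    have hv : EqOn (rlIntegral ((1 - μ) * (2 - β)) u) (cauchyTerm ξ₀ ξ₁ 1 2 w) (Ioi 0) :=
      fun t ht => by
        have ht : 0 < t := ht
        rw [rlIntegral_congr ha ht he,
          (hfc.sub (huc.const_mul lam)).rlIntegral_cauchyTerm hc hδ0 ha ht, sub_add_cancel,
          cauchyTerm, cauchyTerm, ← rlIntegral_congr (by linarith) ht hwe,
          hw.rlIntegral_rlIntegral (by linarith) hb ht]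
        congr 2
        linarith
    obtain ⟨hC, -, h2⟩ := contDiffOn_of_eqOn_cauchyTerm hw hv
    obtain ⟨hl0, hl1⟩ := tendsto_of_eqOn_cauchyTerm hw hv
    refine ⟨huc.continuousOn, huc.integrableOn, hC, ?_, fun t ht => ?_, hl0, hl1⟩
    · exact (hw.congr h2.symm).integrableOn
    · have h3 := hwe ht
      rw [← rlIntegral_congr hb ht h2] at h3
      simp only [hilferDeriv, Nat.cast_ofNat]
      rw [h3, sub_add_cancel]
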